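/- **Definitions.** Let $K$ be a finite simplicial complex of dimension $d$ (the empty set is not counted as a face). A *discrete Morse function* on $K$ (Forman) is a real function $f$ on the faces of $K$ such that for each face $\sigma$ there is at most one face $\tau\supset\sigma$ with $\dim\tau=\dim\sigma+1$ and $f(\tau)\le f(\sigma)$, and at most one face $\rho\subset\sigma$ with $\dim\rho=\dim\sigma-1$ and $f(\rho)\ge f(\sigma)$. The face $\sigma$ is *critical* if there is no such $\tau$ and no such $\rho$. The *discrete Morse vector* of $f$ is $(c_0,\dots,c_d)$, where $c_i$ is the number of critical $i$-dimensional faces. A vector is an *optimal discrete Morse vector* of $K$ if it is the discrete Morse vector of some discrete Morse function on $K$ and no discrete Morse function on $K$ has a smaller total number of critical faces. **The complexes.** Each complex below is generated by the images of the listed sets under the permutation group generated by the listed permutations (these images are its facets). $\mathtt{SU2\_SO3}$ (a 13-vertex triangulation of the 5-manifold $SU(3)/SO(3)$; 156 facets): vertices $0,\dots,12$; permutations $x\mapsto x+1$ and $x\mapsto 3x$ modulo $13$; sets $\{0,1,2,4,5,8\}, \{0,1,2,4,5,11\}, \{0,1,2,4,7,8\}, \{0,1,2,4,7,9\}, \{0,1,2,7,8,10\},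 \{0,1,2,7,10,11\}.$ $\mathtt{RP5\_24}$ (a 24-vertex triangulation of ${\mathbb R}{\bf P}^5$; 676 facets): vertices $0,\dots,23$; permutations $(0\,2\,4)(1\,3\,5)(6\,8\,10)(7\,9\,11)(12\,14\,16)(13\,15\,17)(18\,20\,22)(19\,21\,23)$ and $(0\,1)(2\,3)(6\,7)(8\,9)(12\,13)(14\,15)(18\,19)(20\,21)$; sets $\{0,2,4,13,15,17\}, \{0,2,4,13,15,18\}, \{0,2,4,13,18,22\}, \{0,2,4,18,20,22\}, \{0,2,8,11,14,19\}, \{0,2,8,11,14,22\}, \{0,2,8,11,19,20\}, \{0,2,8,11,20,22\}, \{0,2,8,14,18,19\}, \{0,2,8,14,18,22\}, \{0,2,8,18,19,20\}, \{0,2,8,18,20,22\}, \{0,2,11,13,14,19\}, \{0,2,11,13,14,22\}, \{0,2,11,13,17,19\}, \{0,2,11,13,17,22\}, \{0,2,11,17,19,20\}, \{0,2,11,17,20,22\}, \{0,2,13,14,18,19\}, \{0,2,13,14,18,22\}, \{0,2,13,15,17,19\}, \{0,2,13,15,18,19\}, \{0,2,15,17,19,20\}, \{0,2,15,18,19,20\},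 \{0,6,8,9,12,20\}, \{0,6,8,9,18,20\}, \{0,6,8,12,20,22\}, \{0,6,8,18,20,22\}, \{0,7,8,9,12,20\}, \{0,7,8,9,19,20\}, \{0,7,8,11,12,16\}, \{0,7,8,11,12,20\}, \{0,7,8,11,16,19\}, \{0,7,8,11,19,20\}, \{0,7,8,12,16,21\}, \{0,7,8,16,19,21\}, \{0,7,10,12,16,17\}, \{0,7,10,12,16,21\}, \{0,7,10,16,17,19\}, \{0,7,10,16,19,21\}, \{0,8,9,18,19,20\}, \{0,8,11,12,16,22\}, \{0,8,11,12,20,22\}, \{0,8,11,14,16,19\}, \{0,8,11,14,16,22\}, \{0,8,14,16,19,21\}, \{0,8,14,18,19,21\}, \{0,10,12,16,17,23\}, \{0,10,12,16,21,23\}, \{0,10,13,15,17,19\}, \{0,10,13,15,17,23\}, \{0,10,13,16,17,19\}, \{0,10,13,16,17,23\}, \{0,12,16,17,22,23\}, \{0,13,16,17,22,23\}, \{6,7,10,16,17,18\}, \{6,8,10,13,15,17\}, \{6,8,10,18,20,22\}, \{6,8,12,13,15,21\}, \{6,8,13,15,17,21\}.$ $\mathtt{\_HP2}$ (the vertex-transitive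 15-vertex triangulation, due to Brehm and Kühnel, of an 8-manifold like a quaternionic projective plane; 490 facets): vertices $0,\dots,14$; permutations $(0\,1\,2\,3\,4)(5\,6\,7\,8\,9)(10\,11\,12\,13\,14)$ and $(0\,5\,10)(1\,14\,13)(2\,12\,7)(3\,6\,4)(8\,11\,9)$; sets $\{0,1,2,5,7,10,12,13,14\}, \{0,2,5,7,8,9,10,11,12\}, \{0,1,5,8,9,10,11,13,14\}, \{0,1,2,3,6,8,11,13,14\}, \{0,1,3,6,8,9,11,12,13\}, \{0,1,5,7,8,9,10,13,14\}, \{0,1,2,3,4,5,8,10,12\}, \{0,2,4,5,7,8,9,10,11\}, \{0,2,4,5,6,7,8,9,10\}, \{0,1,2,3,4,6,9,11,14\}, \{0,1,2,6,7,9,11,12,13\}, \{1,4,5,6,7,8,9,12,13\}, \{2,3,5,6,10,11,12,13,14\}, \{2,3,5,6,9,11,12,13,14\}.$ **Theorem.** The triangulations $\mathtt{SU2\_SO3}$, $\mathtt{RP5\_24}$ and $\mathtt{\_HP2}$ have optimal discrete Morse vectors $(1,0,1,1,0,1)$, $(1,1,1,1,1,1)$ and $(1,0,0,0,1,0,0,0,1)$,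 respectively, and in each case this is the only optimal discrete Morse vector. -/

import Mathlib

/-- `f` assigns a real number to each face of `K` (its values elsewhere play no role). It is a
discrete Morse function in the sense of Forman if each face `σ` has at most one coface `τ` of one
dimension more with `f τ ≤ f σ` and at most one face `ρ` of one dimension less with `f σ ≤ f ρ`.
The empty set does not count as a face. -/
def IsDiscreteMorse {V : Type*} (K : PreAbstractSimplicialComplex V) (f : Finset V → ℝ) : Prop :=
  ∀ σ ∈ K, {τ | τ ∈ K ∧ σ ⋖ τ ∧ f τ ≤ f σ}.Subsingleton ∧
    {ρ | ρ ∈ K ∧ ρ ⋖ σ ∧ f σ ≤ f ρ}.Subsingleton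

/-- The face `σ` of `K` is critical for `f` if neither of the two exceptional sets has a member. -/
def IsCriticalFace {V : Type*} (K : PreAbstractSimplicialComplex V) (f : Finset V → ℝ)
    (σ : Finset V) : Prop :=
  σ ∈ K ∧ (∀ τ ∈ K, σ ⋖ τ → f σ < f τ) ∧ ∀ ρ ∈ K, ρ ⋖ σ → f ρ < f σ

/-- The dimension of a nonempty complex with finitely many vertices. -/
noncomputable def complexDim {V : Type*} [Finite V] (K : PreAbstractSimplicialComplex V) : ℕ :=
  sSup {i | ∃ σ ∈ K, σ.card = i + 1}

/-- The discrete Morse vector `(c_0, …, c_d)` of `f`, where `d` is the dimension of `K` and `c_i`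
is the number of critical faces of dimension `i`. -/
noncomputable def morseVector {V : Type*} [Finite V] (K : PreAbstractSimplicialComplex V)
    (f : Finset V → ℝ) : List ℕ :=
  (List.range (complexDim K + 1)).map fun i =>
    {σ : Finset V | IsCriticalFace K f σ ∧ σ.card = i + 1}.ncard

/-- `v` is an optimal discrete Morse vector of `K`: it is the vector of some discrete Morse function
on `K`, and no discrete Morse function on `K` has fewer critical faces in total. -/
def IsOptimalMorseVector {V : Type*} [Finite V] (K : PreAbstractSimplicialComplex V)
    (v : List ℕ) : Prop :=
  (∃ f, IsDiscreteMorse K f ∧ morseVector K f = v) ∧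
    ∀ g, IsDiscreteMorse K g → v.sum ≤ (morseVector K g).sum

/-- The simplicial complex on `Fin n` whose facets are the images of the sets in `reps` under the
permutation group generated by `gens`: its faces are the nonempty subsets of these images. -/
def orbitComplex {n : ℕ} (gens : Set (Equiv.Perm (Fin n))) (reps : List (Finset (Fin n))) :
    PreAbstractSimplicialComplex (Fin n) where
  faces := {s | s.Nonempty ∧
    ∃ g ∈ Subgroup.closure gens, ∃ F ∈ reps, s ⊆ F.map g.toEmbedding}
  isRelLowerSet_faces := by
    rintro s ⟨hs, g, hg, F, hF, hsF⟩
    exact ⟨hs, fun t hts ht => ⟨ht, g, hg, F, hF, hts.trans hsF⟩⟩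

/-- The 13-vertex triangulation of the simply connected 5-manifold `SU(3)/SO(3)`. It is invariant
under the group of order 39 generated by `x ↦ x + 1` and `x ↦ 3 x` modulo 13, and it has
`f`-vector (13, 78, 286, 533, 468, 156). -/
def SU2_SO3 : PreAbstractSimplicialComplex (Fin 13) :=
  orbitComplex
    {[0, 1, 2, 3, 4, 5, 6, 7, 8, 9, 10, 11, 12].formPerm,
      [1, 3, 9].formPerm * [2, 6, 5].formPerm * [4, 12, 10].formPerm * [7, 8, 11].formPerm}
    [{0, 1, 2, 4, 5, 8}, {0, 1, 2, 4, 5, 11}, {0, 1, 2, 4, 7, 8},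
    {0, 1, 2, 4, 7, 9}, {0, 1, 2, 7, 8, 10}, {0, 1, 2, 7, 10, 11}]

/-- The 24-vertex triangulation of real projective 5-space with `f`-vector
(24, 273, 1174, 2277, 2028, 676). It is invariant under a group of order 12 (the rotation group of
a tetrahedron): the vertex `6 t + 2 i + s`, for `t < 4`, `i < 3`, `s < 2`, may be thought of as the
point `(-1) ^ s • e i` in the `t`-th copy of the set of signed coordinate vectors of 3-space. The
first generator rotates the three coordinates, the second one changes the sign of two of them. -/
def RP5_24 : PreAbstractSimplicialComplex (Fin 24) :=
  orbitComplex
    {[0, 2, 4].formPerm * [1, 3, 5].formPerm * [6, 8, 10].formPerm * [7, 9, 11].formPerm *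
        [12, 14, 16].formPerm * [13, 15, 17].formPerm *
        [18, 20, 22].formPerm * [19, 21, 23].formPerm,
      [0, 1].formPerm * [2, 3].formPerm * [6, 7].formPerm * [8, 9].formPerm *
        [12, 13].formPerm * [14, 15].formPerm * [18, 19].formPerm * [20, 21].formPerm}
    [{0, 2, 4, 13, 15, 17}, {0, 2, 4, 13, 15, 18}, {0, 2, 4, 13, 18, 22},
    {0, 2, 4, 18, 20, 22}, {0, 2, 8, 11, 14, 19}, {0, 2, 8, 11, 14, 22},
    {0, 2, 8, 11, 19, 20}, {0, 2, 8, 11, 20, 22}, {0, 2, 8, 14, 18, 19},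
    {0, 2, 8, 14, 18, 22}, {0, 2, 8, 18, 19, 20}, {0, 2, 8, 18, 20, 22},
    {0, 2, 11, 13, 14, 19}, {0, 2, 11, 13, 14, 22}, {0, 2, 11, 13, 17, 19},
    {0, 2, 11, 13, 17, 22}, {0, 2, 11, 17, 19, 20}, {0, 2, 11, 17, 20, 22},
    {0, 2, 13, 14, 18, 19}, {0, 2, 13, 14, 18, 22}, {0, 2, 13, 15, 17, 19},
    {0, 2, 13, 15, 18, 19}, {0, 2, 15, 17, 19, 20}, {0, 2, 15, 18, 19, 20},
    {0, 6, 8, 9, 12, 20}, {0, 6, 8, 9, 18, 20}, {0, 6, 8, 12, 20, 22},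
    {0, 6, 8, 18, 20, 22}, {0, 7, 8, 9, 12, 20}, {0, 7, 8, 9, 19, 20},
    {0, 7, 8, 11, 12, 16}, {0, 7, 8, 11, 12, 20}, {0, 7, 8, 11, 16, 19},
    {0, 7, 8, 11, 19, 20}, {0, 7, 8, 12, 16, 21}, {0, 7, 8, 16, 19, 21},
    {0, 7, 10, 12, 16, 17}, {0, 7, 10, 12, 16, 21}, {0, 7, 10, 16, 17, 19},
    {0, 7, 10, 16, 19, 21}, {0, 8, 9, 18, 19, 20}, {0, 8, 11, 12, 16, 22},
    {0, 8, 11, 12, 20, 22}, {0, 8, 11, 14, 16, 19}, {0, 8, 11, 14, 16, 22},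
    {0, 8, 14, 16, 19, 21}, {0, 8, 14, 18, 19, 21}, {0, 10, 12, 16, 17, 23},
    {0, 10, 12, 16, 21, 23}, {0, 10, 13, 15, 17, 19}, {0, 10, 13, 15, 17, 23},
    {0, 10, 13, 16, 17, 19}, {0, 10, 13, 16, 17, 23}, {0, 12, 16, 17, 22, 23},
    {0, 13, 16, 17, 22, 23}, {6, 7, 10, 16, 17, 18}, {6, 8, 10, 13, 15, 17},
    {6, 8, 10, 18, 20, 22}, {6, 8, 12, 13, 15, 21}, {6, 8, 13, 15, 17, 21}]

/-- The vertex-transitive 15-vertex triangulation of an 8-manifold like a quaternionic projective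
plane, due to Brehm and Kühnel, with vertices `0, …, 14` instead of `1, …, 15`. It is invariant
under a group of order 60 and has
`f`-vector (15, 105, 455, 1365, 3003, 4515, 4230, 2205, 490). -/
def HP2 : PreAbstractSimplicialComplex (Fin 15) :=
  orbitComplex
    {[0, 1, 2, 3, 4].formPerm * [5, 6, 7, 8, 9].formPerm * [10, 11, 12, 13, 14].formPerm,
      [0, 5, 10].formPerm * [1, 14, 13].formPerm * [2, 12, 7].formPerm *
        [3, 6, 4].formPerm * [8, 11, 9].formPerm}
    [{0, 1, 2, 5, 7, 10, 12, 13, 14}, {0, 2, 5, 7, 8, 9, 10, 11, 12},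
    {0, 1, 5, 8, 9, 10, 11, 13, 14}, {0, 1, 2, 3, 6, 8, 11, 13, 14},
    {0, 1, 3, 6, 8, 9, 11, 12, 13}, {0, 1, 5, 7, 8, 9, 10, 13, 14},
    {0, 1, 2, 3, 4, 5, 8, 10, 12}, {0, 2, 4, 5, 7, 8, 9, 10, 11},
    {0, 2, 4, 5, 6, 7, 8, 9, 10}, {0, 1, 2, 3, 4, 6, 9, 11, 14},
    {0, 1, 2, 6, 7, 9, 11, 12, 13}, {1, 4, 5, 6, 7, 8, 9, 12, 13},
    {2, 3, 5, 6, 10, 11, 12, 13, 14}, {2, 3, 5, 6, 9, 11, 12, 13, 14}]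

/-!
The discrete Morse vectors in question have entries `0` and `1`, and each entry is a lower bound for
every discrete Morse function. So the vector is optimal as soon as it is attained, and no other
discrete Morse vector has the same sum.

*Lower bound.* Suppose that `z` is a cycle and `φ` a cocycle modulo 2 in dimension `i`, and that
they have exactly one face in common. If a discrete Morse function had no critical face of dimension
`i`, one could push `z` down along the gradient, by adding boundaries of faces of dimension `i + 1`,
until nothing is left of it. As `φ` vanishes on boundaries, it would vanish on `z`, a contradiction.
This is `sum_mul_eq_zero_of_no_critical`. It is applied to explicit pairs of a cycle and a cocycle.

*Upper bound.* A family `P` of faces that is closed under subsets (the empty set included) is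
reduced in two ways. Either a maximal face is removed and becomes critical
(`IsGradient.insert_face`). Or a vertex `v` is chosen, and both `σ` and `σ ∪ {v}` are removed for
each face `σ` without `v` such that all faces of `P` which contain `σ` but not `v` belong to the
link of `v` (`IsGradient.of_collapseAt`). Toggling `v` is a perfect matching of the faces that the
second operation removes, and giving larger values to faces that are removed earlier turns a
reduction of the whole complex to nothing into a discrete Morse function
(`IsGradient.exists_isDiscreteMorse`). In the end one vertex is matched with the empty set, which is
the critical vertex.

*Computation.* The complexes have up to 16383 faces, so the families of faces are encoded as natural
numbers: each vertex has a weight, and the face `σ` stands for the binary digit whose place is the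
sum of the weights of its vertices. Links, closures, boundaries and coboundaries then become a few
shifts and bitwise operations per vertex, which the kernel evaluates on numbers. The lemmas
`isFaceCode_of_check`, `exists_isGradient_of_check` and `exists_isCriticalFace_of_check` say what
these computations prove, and `exists_facets_of_check` derives the facets from the given
permutations and sets. All is combined in `isOptimalMorseVector_orbitComplex`.
-/

/-! ### A mod 2 Morse inequality -/

section MorseInequality

theorem mem_of_covBy {V : Type*} {K : PreAbstractSimplicialComplex V} {σ τ : Finset V}
    (hτ : τ ∈ K) (h : σ ⋖ τ) (hσ : σ.Nonempty) : σ ∈ K :=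
  (K.isRelLowerSet_faces hτ).2 h.le hσ

theorem card_of_covBy {V : Type*} {σ τ : Finset V} (h : σ ⋖ τ) : τ.card = σ.card + 1 := by
  classical
  obtain ⟨a, ha, rfl⟩ := (Finset.covBy_iff_exists_insert).1 h
  exact Finset.card_insert_of_notMem ha

variable {V : Type*} [Fintype V] [DecidableEq V]

open Classical in
/-- The boundary of the boundary of `τ` is zero modulo 2, at the face `ρ`. -/
theorem sum_boundary_covBy (ρ τ : Finset V) :
    ∑ a ∈ ρᶜ, (if insert a ρ ⋖ τ then (1 : ZMod 2) else 0) = 0 := by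
  by_cases h : ρ ⊆ τ ∧ (τ \ ρ).card = 2
  · have : ∀ a ∈ ρᶜ, (if insert a ρ ⋖ τ then (1 : ZMod 2) else 0) = if a ∈ τ then 1 else 0 := by
      intro a ha
      rw [Finset.mem_compl] at ha
      refine if_congr ?_ rfl rfl
      rw [Finset.covBy_iff_card_sdiff_eq_one, Finset.insert_subset_iff]
      constructor
      · exact fun h => h.1.1
      · intro haτ
        refine ⟨⟨haτ, h.1⟩, ?_⟩
        rw [Finset.sdiff_insert, Finset.card_erase_of_mem (by simp [ha, haτ]), h.2]
    rw [Finset.sum_congr rfl this, Finset.sum_ite_mem, Finset.sum_const]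
    have e : ρᶜ ∩ τ = τ \ ρ := by ext; simp [and_comm]
    rw [e, h.2]
    decide
  · refine Finset.sum_eq_zero fun a ha => if_neg fun hc => h ?_
    rw [Finset.mem_compl] at ha
    rw [Finset.covBy_iff_card_sdiff_eq_one, Finset.insert_subset_iff, Finset.sdiff_insert] at hc
    refine ⟨hc.1.2, ?_⟩
    have := Finset.card_erase_of_mem (s := τ \ ρ) (a := a) (by simp [ha, hc.1.1])
    have : 0 < (τ \ ρ).card := Finset.card_pos.2 ⟨a, by simp [ha, hc.1.1]⟩
    omega

open Classical in
theorem sum_covBy_eq_sum_erase (τ : Finset V) (φ : Finset V → ZMod 2) :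
    ∑ ω, (if ω ⋖ τ then (1 : ZMod 2) else 0) * φ ω = ∑ a ∈ τ, φ (τ.erase a) := by
  have himg : Finset.univ.filter (· ⋖ τ) = τ.image τ.erase := by
    ext ω
    simp only [Finset.mem_filter, Finset.mem_univ, true_and, Finset.mem_image]
    rw [Finset.covBy_iff_exists_insert]
    constructor
    · rintro ⟨a, ha, rfl⟩
      exact ⟨a, Finset.mem_insert_self _ _, Finset.erase_insert ha⟩
    · rintro ⟨a, ha, rfl⟩
      exact ⟨a, Finset.notMem_erase _ _, Finset.insert_erase ha⟩
  simp only [ite_mul, one_mul, zero_mul]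
  rw [← Finset.sum_filter, himg, Finset.sum_image]
  exact fun a ha b _ h => (Finset.erase_inj τ ha).1 h

variable {K : PreAbstractSimplicialComplex V} {f : Finset V → ℝ}

open Classical in
/-- A measure of the part of the chain `z` carried by faces that `f` pairs with a coface. It drops
when the boundary of such a coface is added to `z`, because this trades the face for faces with
smaller values. -/
noncomputable def upWeight (K : PreAbstractSimplicialComplex V) (f : Finset V → ℝ)
    (z : Finset V → ZMod 2) : ℕ :=
  ∑ σ with z σ ≠ 0 ∧ ∃ τ ∈ K, σ ⋖ τ ∧ f τ ≤ f σ,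
    (Fintype.card (Finset V) + 1) ^ (Finset.univ.filter fun ρ => f ρ < f σ).card

open Classical in
theorem upWeight_lt (hf : IsDiscreteMorse K f) {z : Finset V → ZMod 2} {σ τ : Finset V}
    (hσ : σ.Nonempty) (hz : z σ ≠ 0) (hτ : τ ∈ K) (hστ : σ ⋖ τ) (hle : f τ ≤ f σ) :
    upWeight K f (fun ω => z ω + if ω ⋖ τ then 1 else 0) < upWeight K f z := by
  set N := Fintype.card (Finset V) + 1 with hN
  set w : Finset V → ℕ := fun σ => N ^ (Finset.univ.filter fun ρ => f ρ < f σ).card with hw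
  set S := Finset.univ.filter fun σ => z σ ≠ 0 ∧ ∃ τ ∈ K, σ ⋖ τ ∧ f τ ≤ f σ with hS
  set A := Finset.univ.filter fun ω => ω ⋖ τ ∧ ω ≠ σ with hA
  have hsub : (Finset.univ.filter fun ω => z ω + (if ω ⋖ τ then 1 else 0) ≠ 0 ∧
      ∃ τ ∈ K, ω ⋖ τ ∧ f τ ≤ f ω) ⊆ S.erase σ ∪ A := by
    intro ω hω
    simp only [Finset.mem_filter, Finset.mem_univ, true_and, hS, hA, Finset.mem_union,
      Finset.mem_erase] at hω ⊢
    have two : ∀ x : ZMod 2, x ≠ 0 → x + 1 = 0 := by decide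
    by_cases h1 : ω = σ
    · subst h1
      exact absurd (by rw [if_pos hστ]; exact two _ hz) hω.1
    · by_cases h2 : ω ⋖ τ
      · exact Or.inr ⟨h2, h1⟩
      · rw [if_neg h2, add_zero] at hω
        exact Or.inl ⟨h1, hω⟩
  have hσS : σ ∈ S := by
    simp only [hS, Finset.mem_filter, Finset.mem_univ, true_and]
    exact ⟨hz, τ, hτ, hστ, hle⟩
  -- `τ` has at most one facet with a value not below its own, and `σ` is one.
  have hAlt : ∀ ω ∈ A, f ω < f σ := by
    intro ω hω
    simp only [hA, Finset.mem_filter, Finset.mem_univ, true_and] at hω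
    by_contra hlt
    refine hω.2 ((hf τ hτ).2 ⟨?_, hω.1, hle.trans (not_lt.1 hlt)⟩
      ⟨mem_of_covBy hτ hστ hσ, hστ, hle⟩)
    refine mem_of_covBy hτ hω.1 ?_
    have h1 := card_of_covBy hω.1
    have h2 := card_of_covBy hστ
    have h3 := Finset.card_pos.2 hσ
    exact Finset.card_pos.1 (by omega)
  have hAsum : ∑ ω ∈ A, w ω < w σ := by
    rcases A.eq_empty_or_nonempty with h | ⟨ω₀, h₀⟩
    · rw [h, Finset.sum_empty]
      exact pow_pos (Nat.succ_pos _) _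
    · have hrk : ∀ ω ∈ A, (Finset.univ.filter fun ρ => f ρ < f ω).card <
          (Finset.univ.filter fun ρ => f ρ < f σ).card := by
        intro ω hω
        refine Finset.card_lt_card (Finset.ssubset_iff_of_subset ?_ |>.2 ⟨ω, ?_, ?_⟩)
        · intro ρ hρ
          simp only [Finset.mem_filter, Finset.mem_univ, true_and] at hρ ⊢
          exact hρ.trans (hAlt ω hω)
        · simpa using hAlt ω hω
        · simp
      obtain ⟨k, hk⟩ : ∃ k, (Finset.univ.filter fun ρ => f ρ < f σ).card = k + 1 :=
        ⟨_, (Nat.succ_pred_eq_of_pos ((Nat.zero_le _).trans_lt (hrk ω₀ h₀))).symm⟩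
      calc ∑ ω ∈ A, w ω ≤ ∑ ω ∈ A, N ^ k := Finset.sum_le_sum fun ω hω =>
            Nat.pow_le_pow_right (Nat.succ_pos _) (by have := hrk ω hω; omega)
        _ = A.card * N ^ k := by rw [Finset.sum_const, smul_eq_mul]
        _ < N * N ^ k := Nat.mul_lt_mul_of_pos_right
            (Nat.lt_succ_of_le (Finset.card_le_univ A)) (pow_pos (Nat.succ_pos _) _)
        _ = w σ := by simp only [hw, hk, pow_succ, mul_comm]
  calc upWeight K f (fun ω => z ω + if ω ⋖ τ then 1 else 0)
      ≤ ∑ ω ∈ S.erase σ ∪ A, w ω := by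
        unfold upWeight
        refine Finset.sum_le_sum_of_subset ?_
        convert hsub
    _ ≤ ∑ ω ∈ S.erase σ, w ω + ∑ ω ∈ A, w ω := by
        rw [← Finset.sum_union_inter]; exact Nat.le_add_right _ _
    _ < ∑ ω ∈ S.erase σ, w ω + w σ := Nat.add_lt_add_left hAsum _
    _ = ∑ ω ∈ S, w ω := Finset.sum_erase_add _ _ hσS
    _ = upWeight K f z := by
        unfold upWeight
        refine Finset.sum_congr ?_ fun _ _ => rfl
        ext; simp [hS]

/-- If `f` has no critical `i`-face, then every `i`-cocycle vanishes on every `i`-cycle. Boundaries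
of `(i+1)`-faces are added to the cycle until no face of it is paired with a coface. What is left
is zero: a face of it with the largest value would be paired with a face `ρ` of dimension `i - 1`,
and no other face of the cycle could contain `ρ`. -/
theorem sum_mul_eq_zero_of_no_critical (hf : IsDiscreteMorse K f) {i : ℕ}
    (hno : ∀ σ, IsCriticalFace K f σ → σ.card ≠ i + 1) {φ : Finset V → ZMod 2}
    (hφ : ∀ τ ∈ K, τ.card = i + 2 → ∑ a ∈ τ, φ (τ.erase a) = 0)
    (z : Finset V → ZMod 2) (hzK : ∀ σ, z σ ≠ 0 → σ ∈ K ∧ σ.card = i + 1)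
    (hz : ∀ ρ ∈ K, ∑ a ∈ ρᶜ, z (insert a ρ) = 0) :
    ∑ σ, z σ * φ σ = 0 := by
  induction h : upWeight K f z using Nat.strong_induction_on generalizing z with
  | _ m ih =>
  by_cases hup : ∃ σ, z σ ≠ 0 ∧ ∃ τ ∈ K, σ ⋖ τ ∧ f τ ≤ f σ
  · obtain ⟨σ, hσ, τ, hτ, hστ, hle⟩ := hup
    have hσK := hzK σ hσ
    have hne : σ.Nonempty := Finset.card_pos.1 (by omega)
    have hcard : τ.card = i + 2 := by rw [card_of_covBy hστ, hσK.2]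
    have key := ih _ (h ▸ upWeight_lt hf hne hσ hτ hστ hle) _ ?_ ?_ rfl
    · simp only [add_mul, Finset.sum_add_distrib] at key
      rwa [sum_covBy_eq_sum_erase, hφ τ hτ hcard, add_zero] at key
    · intro ω hω
      by_cases h1 : z ω = 0
      · rw [h1, zero_add] at hω
        have hωτ : ω ⋖ τ := by by_contra hc; exact hω (if_neg hc)
        have := card_of_covBy hωτ
        exact ⟨mem_of_covBy hτ hωτ (Finset.card_pos.1 (by omega)), by omega⟩
      · exact hzK ω h1
    · intro ρ hρ
      rw [Finset.sum_add_distrib, hz ρ hρ, sum_boundary_covBy, add_zero]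
  · rcases (Finset.univ.filter fun σ => z σ ≠ 0).eq_empty_or_nonempty with h0 | hne
    · refine Finset.sum_eq_zero fun σ _ => ?_
      have : σ ∉ Finset.univ.filter fun σ => z σ ≠ 0 := by rw [h0]; exact Finset.notMem_empty _
      simp only [Finset.mem_filter, Finset.mem_univ, true_and, not_not] at this
      rw [this, zero_mul]
    · exfalso
      obtain ⟨σ, hσ, hmax⟩ := Finset.exists_max_image _ f hne
      simp only [Finset.mem_filter, Finset.mem_univ, true_and] at hσ hmax
      have hσK := hzK σ hσ
      have hnc := fun hc => hno σ hc hσK.2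
      have hex : ∃ ρ ∈ K, ρ ⋖ σ ∧ f σ ≤ f ρ := by
        by_contra hc
        push Not at hc hup
        exact hnc ⟨hσK.1, fun τ hτ h => hup σ hσ τ hτ h, hc⟩
      obtain ⟨ρ, hρ, hρσ, hle⟩ := hex
      obtain ⟨a, ha, rfl⟩ := (Finset.covBy_iff_exists_insert).1 hρσ
      have hsum := hz ρ hρ
      rw [Finset.sum_eq_single_of_mem a (Finset.mem_compl.2 ha)] at hsum
      · exact hσ hsum
      · intro b hb hba
        rw [Finset.mem_compl] at hb
        by_contra hzb
        have : insert b ρ = insert a ρ := (hf ρ hρ).1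
          ⟨(hzK _ hzb).1, (Finset.covBy_iff_exists_insert).2 ⟨b, hb, rfl⟩, (hmax _ hzb).trans hle⟩
          ⟨hσK.1, hρσ, hle⟩
        have hb' : b ∈ insert a ρ := this ▸ Finset.mem_insert_self b ρ
        exact (Finset.mem_insert.1 hb').elim hba hb

end MorseInequality

/-! ### Discrete Morse functions from sequences of collapses -/

section Collapse

variable {V : Type*} [DecidableEq V]

/-- A gradient on the family `P` with critical faces in `C`: values `f` that increase strictly along
covering pairs of `P`, except along the pairs `σ`, `m σ`, where they are equal. All faces of `P`
outside `C` belong to such a pair. -/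
structure IsGradient (P : Set (Finset V)) (C : List (Finset V)) (f : Finset V → ℕ)
    (m : Finset V → Finset V) : Prop where
  covBy : ∀ ρ ∈ P, ∀ σ ∈ P, ρ ⋖ σ → f ρ < f σ ∨ (f ρ = f σ ∧ m ρ = σ ∧ m σ = ρ)
  matched : ∀ σ ∈ P, σ ∉ C → m σ ∈ P ∧ m (m σ) = σ ∧ f (m σ) = f σ ∧ (σ ⋖ m σ ∨ m σ ⋖ σ)

/-- A maximal face can be added as a critical one, with a value above all others. -/
theorem IsGradient.insert_face [Finite V] {P : Set (Finset V)} {C : List (Finset V)}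
    {f : Finset V → ℕ} {m : Finset V → Finset V} (h : IsGradient P C f m) {σ : Finset V}
    (hσ : σ ∉ P) (hmax : ∀ τ ∈ P, ¬ σ ⋖ τ) :
    ∃ f' m', IsGradient (insert σ P) (σ :: C) f' m' := by
  obtain ⟨M, hM⟩ := (Set.finite_range f).bddAbove
  have hM' : ∀ τ, f τ ≤ M := fun τ => hM ⟨τ, rfl⟩
  have hne : ∀ τ ∈ P, τ ≠ σ := fun τ hτ h => hσ (h ▸ hτ)
  refine ⟨Function.update f σ (M + 1), m, ?_, ?_⟩
  · rintro ρ (rfl | hρ) τ (rfl | hτ) hc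
    · exact absurd hc.lt (lt_irrefl _)
    · exact absurd hc (hmax τ hτ)
    · left
      rw [Function.update_self, Function.update_of_ne (hne _ hρ)]
      exact Nat.lt_succ_of_le (hM' _)
    · rw [Function.update_of_ne (hne _ hρ), Function.update_of_ne (hne _ hτ)]
      exact h.covBy ρ hρ τ hτ hc
  · rintro τ (rfl | hτ) hC
    · exact absurd List.mem_cons_self hC
    · obtain ⟨h1, h2, h3, h4⟩ := h.matched τ hτ fun hc => hC (List.mem_cons_of_mem _ hc)
      refine ⟨Or.inr h1, h2, ?_, h4⟩
      rwa [Function.update_of_ne (hne _ h1), Function.update_of_ne (hne _ hτ)]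

/-- The faces that remain when `σ` and `σ ∪ {v}` are removed for each face `σ` without `v` such that
every face of `P` containing `σ` stays in `P` when `v` is added to it. For a complex `P` this
collapse leads to `D ∪ v * (D ∩ link v)`, where `D` is the closure of the complement of
the closed star of `v`. -/
def collapseAt (v : V) (P : Set (Finset V)) : Set (Finset V) :=
  {σ ∈ P | ∃ τ ∈ P, v ∉ τ ∧ insert v τ ∉ P ∧ σ.erase v ⊆ τ}

theorem isLowerSet_collapseAt {v : V} {P : Set (Finset V)} (hP : IsLowerSet P) :
    IsLowerSet (collapseAt v P) := by
  rintro σ ρ hρσ ⟨hσ, τ, h1, h2, h3, h4⟩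
  exact ⟨hP hρσ hσ, τ, h1, h2, h3, (Finset.erase_subset_erase v hρσ).trans h4⟩

/-- Toggling `v` pairs the removed faces. All of them get values above the old ones, ordered by the
size of the face without `v`. -/
theorem IsGradient.of_collapseAt [Finite V] {P : Set (Finset V)} {C : List (Finset V)}
    {f : Finset V → ℕ} {m : Finset V → Finset V} {v : V} (hP : IsLowerSet P)
    (h : IsGradient (collapseAt v P) C f m) : ∃ f' m', IsGradient P C f' m' := by
  classical
  obtain ⟨M, hM⟩ := (Set.finite_range f).bddAbove
  have hM' : ∀ τ, f τ ≤ M := fun τ => hM ⟨τ, rfl⟩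
  have hlow := isLowerSet_collapseAt (v := v) hP
  set Q := collapseAt v P with hQ
  have herase : ∀ σ ∈ P, σ ∉ Q → v ∈ σ → σ.erase v ∈ P ∧ σ.erase v ∉ Q := by
    intro σ hσ hσQ _
    refine ⟨hP (Finset.erase_subset v σ) hσ,
      fun ⟨_, τ, h1, h2, h3, h4⟩ => hσQ ⟨hσ, τ, h1, h2, h3, ?_⟩⟩
    rwa [Finset.erase_idem] at h4
  have hinsert : ∀ σ ∈ P, σ ∉ Q → v ∉ σ → insert v σ ∈ P ∧ insert v σ ∉ Q := by
    intro σ hσ hσQ hv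
    refine ⟨?_, fun ⟨_, τ, h1, h2, h3, h4⟩ => hσQ ⟨hσ, τ, h1, h2, h3, ?_⟩⟩
    · by_contra hc
      exact hσQ ⟨hσ, σ, hσ, hv, hc, Finset.erase_subset _ _⟩
    · rw [Finset.erase_insert hv] at h4
      exact (Finset.erase_subset _ _).trans h4
  refine ⟨fun σ => if σ ∈ Q then f σ else M + 1 + (σ.erase v).card,
    fun σ => if σ ∈ Q then m σ else if v ∈ σ then σ.erase v else insert v σ, ?_, ?_⟩
  · intro ρ hρ σ hσ hc
    by_cases hσQ : σ ∈ Q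
    · have hρQ : ρ ∈ Q := hlow hc.le hσQ
      simp only [if_pos hσQ, if_pos hρQ]
      exact h.covBy ρ hρQ σ hσQ hc
    · by_cases hρQ : ρ ∈ Q
      · simp only [if_neg hσQ, if_pos hρQ]
        exact Or.inl ((hM' ρ).trans_lt (by omega))
      · simp only [if_neg hσQ, if_neg hρQ]
        obtain ⟨a, ha, rfl⟩ := (Finset.covBy_iff_exists_insert).1 hc
        by_cases hav : a = v
        · subst hav
          right
          simp [ha]
        · left
          rw [Finset.erase_insert_of_ne hav, Finset.card_insert_of_notMem (by simp [ha])]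
          omega
  · intro σ hσ hC
    by_cases hσQ : σ ∈ Q
    · obtain ⟨h1, h2, h3, h4⟩ := h.matched σ hσQ hC
      simp only [if_pos hσQ, if_pos h1]
      exact ⟨h1.1, h2, h3, h4⟩
    · by_cases hv : v ∈ σ
      · obtain ⟨h1, h2⟩ := herase σ hσ hσQ hv
        simp only [if_neg hσQ, if_pos hv, if_neg h2]
        refine ⟨h1, ?_, ?_, Or.inr (Finset.erase_covBy hv)⟩
        · rw [if_neg (Finset.notMem_erase _ _), Finset.insert_erase hv]
        · rw [Finset.erase_idem]
      · obtain ⟨h1, h2⟩ := hinsert σ hσ hσQ hv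
        simp only [if_neg hσQ, if_neg hv, if_neg h2]
        refine ⟨h1, ?_, ?_, Or.inl (Finset.covBy_insert hv)⟩
        · rw [if_pos (Finset.mem_insert_self _ _), Finset.erase_insert hv]
        · rw [Finset.erase_insert hv, Finset.erase_eq_of_notMem hv]

/-- The gradient lives on the faces of `K` together with the empty set. As the latter is not a face
of `K`, its partner is a further critical face, of dimension zero. -/
theorem IsGradient.exists_isDiscreteMorse {K : PreAbstractSimplicialComplex V}
    {C : List (Finset V)} {f : Finset V → ℕ} {m : Finset V → Finset V}
    (h : IsGradient (insert ∅ K.faces) C f m) :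
    ∃ F : Finset V → ℝ, IsDiscreteMorse K F ∧
      ∀ σ, IsCriticalFace K F σ → σ ∈ C ∨ σ = m ∅ ∧ σ.card = 1 := by
  refine ⟨fun σ => f σ, fun σ hσ => ⟨?_, ?_⟩, ?_⟩
  · have key : ∀ τ ∈ {τ | τ ∈ K ∧ σ ⋖ τ ∧ (f τ : ℝ) ≤ f σ}, τ = m σ := by
      rintro τ ⟨hτ, hc, hle⟩
      rcases h.covBy σ (Or.inr hσ) τ (Or.inr hτ) hc with hlt | ⟨_, h2, _⟩
      · exact absurd (Nat.cast_le.1 hle) (not_le.2 hlt)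
      · exact h2.symm
    exact fun τ hτ τ' hτ' => (key τ hτ).trans (key τ' hτ').symm
  · have key : ∀ ρ ∈ {ρ | ρ ∈ K ∧ ρ ⋖ σ ∧ (f σ : ℝ) ≤ f ρ}, ρ = m σ := by
      rintro ρ ⟨hρ, hc, hle⟩
      rcases h.covBy ρ (Or.inr hρ) σ (Or.inr hσ) hc with hlt | ⟨_, _, h2⟩
      · exact absurd (Nat.cast_le.1 hle) (not_le.2 hlt)
      · exact h2.symm
    exact fun τ hτ τ' hτ' => (key τ hτ).trans (key τ' hτ').symm
  · rintro σ ⟨hσ, hup, hdown⟩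
    by_cases hC : σ ∈ C
    · exact Or.inl hC
    · right
      obtain ⟨h1, h2, h3, h4⟩ := h.matched σ (Or.inr hσ) hC
      have h0 : m σ = ∅ := by
        rcases h1 with h1 | h1
        · exact h1
        · exfalso
          rcases h4 with h4 | h4
          · exact absurd (hup _ h1 h4) (by simp [h3])
          · exact absurd (hdown _ h1 h4) (by simp [h3])
      rw [h0] at h2 h4
      refine ⟨h2.symm, ?_⟩
      rcases h4 with h4 | h4
      · exact absurd h4.lt (not_lt_bot)
      · rw [card_of_covBy h4, Finset.card_empty]

end Collapse

/-! ### Evaluation by literals -/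

section Evaluation

variable {α β : Type*}

/-- The value `k x`. As this is defined by recursion on `x`, the reduction to normal form by the
kernel computes the number `x` before it is handed to `k`, so that it is computed only once. -/
def withValue (x : ℕ) (k : ℕ → α) : α :=
  match x with
  | 0 => k 0
  | x + 1 => k (x + 1)

@[simp]
theorem withValue_eq (x : ℕ) (k : ℕ → α) : withValue x k = k x := by
  cases x <;> rfl

/-- The value `k l`, where the numbers in the list `l` are computed first. -/
def withValues (l : List ℕ) (k : List ℕ → α) : α :=
  match l with
  | [] => k []
  | x :: l => withValue x fun x => withValues l fun l => k (x :: l)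

@[simp]
theorem withValues_eq (l : List ℕ) (k : List ℕ → α) : withValues l k = k l := by
  induction l generalizing k with
  | nil => rfl
  | cons x l ih => rw [withValues, withValue_eq, ih]

/-- The value `k l`, where the numbers in the lists in `l` are computed first. -/
def withLists (l : List (List ℕ)) (k : List (List ℕ) → α) : α :=
  match l with
  | [] => k []
  | x :: l => withValues x fun x => withLists l fun l => k (x :: l)

@[simp]
theorem withLists_eq (l : List (List ℕ)) (k : List (List ℕ) → α) : withLists l k = k l := by
  induction l generalizing k with
  | nil => rfl
  | cons x l ih => rw [withLists, withValues_eq, ih]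

/-- The value `k l`, where the numbers in the pairs in `l` are computed first. -/
def withPairs (l : List (ℕ × ℕ)) (k : List (ℕ × ℕ) → α) : α :=
  match l with
  | [] => k []
  | x :: l => withValue x.1 fun a => withValue x.2 fun b => withPairs l fun l => k ((a, b) :: l)

@[simp]
theorem withPairs_eq (l : List (ℕ × ℕ)) (k : List (ℕ × ℕ) → α) : withPairs l k = k l := by
  induction l generalizing k with
  | nil => rfl
  | cons x l ih => rw [withPairs, withValue_eq, withValue_eq, ih]

/-- The left fold, where each intermediate result is computed at once. -/
def foldValue (g : ℕ → β → ℕ) (X : ℕ) : List β → ℕ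
  | [] => X
  | d :: l => withValue (g X d) fun X => foldValue g X l

@[simp]
theorem foldValue_eq (g : ℕ → β → ℕ) (X : ℕ) (l : List β) : foldValue g X l = l.foldl g X := by
  induction l generalizing X with
  | nil => rfl
  | cons d l ih => rw [foldValue, withValue_eq, ih, List.foldl_cons]

end Evaluation

/-! ### Families of faces as natural numbers -/

section Bits

/-- The position of the bit that stands for a face: the sum of the weights of its vertices. -/
def faceIndex {n : ℕ} (w : Fin n → ℕ) (σ : Finset (Fin n)) : ℕ := ∑ v ∈ σ, w v

/-- The index of a face determines it among the members of the complex `𝒦` (which contains the empty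
set): the bit of `M v` at this place says whether `v` is a vertex. The bits of `B` are those of the
members of `𝒦`. -/
structure IsFaceCode {n : ℕ} (𝒦 : Set (Finset (Fin n))) (w M : Fin n → ℕ) (B : ℕ) : Prop where
  isLowerSet : IsLowerSet 𝒦
  testBit_mask : ∀ σ ∈ 𝒦, ∀ v, (M v).testBit (faceIndex w σ) = true ↔ v ∈ σ
  testBit_all : ∀ j, B.testBit j = true ↔ ∃ σ ∈ 𝒦, faceIndex w σ = j

/-- The number `X` has its ones at the places of the members of `P`. -/
def Codes {n : ℕ} (𝒦 : Set (Finset (Fin n))) (w : Fin n → ℕ) (X : ℕ) (P : Set (Finset (Fin n))) :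
    Prop :=
  P ⊆ 𝒦 ∧ ∀ j, X.testBit j = true ↔ ∃ σ ∈ P, faceIndex w σ = j

variable {n : ℕ} {𝒦 : Set (Finset (Fin n))} {w M : Fin n → ℕ} {B X Y : ℕ}
  {P Q : Set (Finset (Fin n))}

theorem faceIndex_insert {v : Fin n} {σ : Finset (Fin n)} (h : v ∉ σ) :
    faceIndex w (insert v σ) = faceIndex w σ + w v := by
  rw [faceIndex, Finset.sum_insert h, add_comm, faceIndex]

theorem faceIndex_erase_add {v : Fin n} {σ : Finset (Fin n)} (h : v ∈ σ) :
    faceIndex w (σ.erase v) + w v = faceIndex w σ := Finset.sum_erase_add _ _ h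

theorem faceIndex_empty : faceIndex w ∅ = 0 := Finset.sum_empty

namespace IsFaceCode

theorem codes_all (h : IsFaceCode 𝒦 w M B) : Codes 𝒦 w B 𝒦 := ⟨subset_rfl, h.testBit_all⟩

theorem injOn (h : IsFaceCode 𝒦 w M B) : Set.InjOn (faceIndex w) 𝒦 := by
  intro σ hσ τ hτ e
  ext v
  rw [← h.testBit_mask σ hσ, e, h.testBit_mask τ hτ]

theorem testBit_iff (h : IsFaceCode 𝒦 w M B) (hX : Codes 𝒦 w X P) {σ : Finset (Fin n)}
    (hσ : σ ∈ 𝒦) : X.testBit (faceIndex w σ) = true ↔ σ ∈ P := by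
  rw [hX.2]
  constructor
  · rintro ⟨τ, hτ, e⟩
    rwa [← h.injOn (hX.1 hτ) hσ e]
  · exact fun hP => ⟨σ, hP, rfl⟩

theorem codes_and (h : IsFaceCode 𝒦 w M B) (hX : Codes 𝒦 w X P) (hY : Codes 𝒦 w Y Q) :
    Codes 𝒦 w (X &&& Y) (P ∩ Q) := by
  refine ⟨Set.inter_subset_left.trans hX.1, fun j => ?_⟩
  rw [Nat.testBit_and, Bool.and_eq_true, hX.2]
  constructor
  · rintro ⟨⟨σ, hσ, rfl⟩, hj⟩
    exact ⟨σ, ⟨hσ, (h.testBit_iff hY (hX.1 hσ)).1 hj⟩, rfl⟩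
  · rintro ⟨σ, hσ, rfl⟩
    exact ⟨⟨σ, hσ.1, rfl⟩, (hY.2 _).2 ⟨σ, hσ.2, rfl⟩⟩

theorem codes_xor (h : IsFaceCode 𝒦 w M B) (hX : Codes 𝒦 w X P) (hY : Codes 𝒦 w Y Q)
    (hQP : Q ⊆ P) : Codes 𝒦 w (X ^^^ Y) (P \ Q) := by
  refine ⟨Set.sdiff_subset.trans hX.1, fun j => ?_⟩
  have hYX : Y.testBit j = true → X.testBit j = true := by
    rw [hX.2, hY.2]
    exact fun ⟨σ, hσ, e⟩ => ⟨σ, hQP hσ, e⟩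
  have : (X ^^^ Y).testBit j = true ↔ X.testBit j = true ∧ ¬ Y.testBit j = true := by
    rw [Nat.testBit_xor]
    revert hYX
    cases X.testBit j <;> cases Y.testBit j <;> simp
  rw [this, hX.2]
  constructor
  · rintro ⟨⟨σ, hσ, rfl⟩, hj⟩
    exact ⟨σ, ⟨hσ, fun hQ => hj ((hY.2 _).2 ⟨σ, hQ, rfl⟩)⟩, rfl⟩
  · rintro ⟨σ, hσ, rfl⟩
    exact ⟨⟨σ, hσ.1, rfl⟩, fun hj => hσ.2 ((h.testBit_iff hY (hX.1 hσ.1)).1 hj)⟩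

/-- Shifting down by `w v` removes the vertex `v`. -/
theorem codes_link (h : IsFaceCode 𝒦 w M B) (hX : Codes 𝒦 w X P) (v : Fin n) :
    Codes 𝒦 w ((X &&& M v) >>> w v) {σ | v ∉ σ ∧ insert v σ ∈ P} := by
  refine ⟨fun σ hσ => h.isLowerSet (Finset.subset_insert v σ) (hX.1 hσ.2), fun j => ?_⟩
  rw [Nat.testBit_shiftRight, Nat.testBit_and, Bool.and_eq_true, hX.2]
  constructor
  · rintro ⟨⟨τ, hτ, e⟩, hj⟩
    rw [← e, h.testBit_mask τ (hX.1 hτ)] at hj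
    refine ⟨τ.erase v, ⟨Finset.notMem_erase _ _, by rwa [Finset.insert_erase hj]⟩, ?_⟩
    have := faceIndex_erase_add (w := w) hj
    omega
  · rintro ⟨σ, hσ, rfl⟩
    have e : w v + faceIndex w σ = faceIndex w (insert v σ) := by
      rw [faceIndex_insert hσ.1, add_comm]
    rw [e, h.testBit_mask _ (hX.1 hσ.2)]
    exact ⟨⟨_, hσ.2, rfl⟩, Finset.mem_insert_self _ _⟩

/-- Shifting up by `w v` adds the vertex `v`. -/
theorem codes_join (h : IsFaceCode 𝒦 w M B) (hX : Codes 𝒦 w X P) (v : Fin n) :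
    Codes 𝒦 w ((X <<< w v) &&& M v &&& B) {τ ∈ 𝒦 | v ∈ τ ∧ τ.erase v ∈ P} := by
  refine ⟨Set.sep_subset _ _, fun j => ?_⟩
  rw [Nat.testBit_and, Nat.testBit_and, Bool.and_eq_true, Bool.and_eq_true, Nat.testBit_shiftLeft,
    Bool.and_eq_true, decide_eq_true_eq, h.testBit_all]
  constructor
  · rintro ⟨⟨⟨hle, hj⟩, hM⟩, τ, hτ, rfl⟩
    have hv := (h.testBit_mask τ hτ v).1 hM
    refine ⟨τ, ⟨hτ, hv, ?_⟩, rfl⟩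
    rw [← h.testBit_iff hX (h.isLowerSet (Finset.erase_subset v τ) hτ)]
    rwa [← faceIndex_erase_add (w := w) hv, Nat.add_sub_cancel] at hj
  · rintro ⟨τ, ⟨hτ, hv, hP⟩, rfl⟩
    have e := faceIndex_erase_add (w := w) hv
    refine ⟨⟨⟨by omega, ?_⟩, (h.testBit_mask τ hτ v).2 hv⟩, τ, hτ, rfl⟩
    rw [← e, Nat.add_sub_cancel]
    exact (hX.2 _).2 ⟨_, hP, rfl⟩

end IsFaceCode

theorem Codes.union (hX : Codes 𝒦 w X P) (hY : Codes 𝒦 w Y Q) : Codes 𝒦 w (X ||| Y) (P ∪ Q) := by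
  refine ⟨Set.union_subset hX.1 hY.1, fun j => ?_⟩
  rw [Nat.testBit_or, Bool.or_eq_true, hX.2, hY.2]
  constructor
  · rintro (⟨σ, hσ, e⟩ | ⟨σ, hσ, e⟩)
    exacts [⟨σ, Or.inl hσ, e⟩, ⟨σ, Or.inr hσ, e⟩]
  · rintro ⟨σ, hσ | hσ, e⟩
    exacts [Or.inl ⟨σ, hσ, e⟩, Or.inr ⟨σ, hσ, e⟩]

theorem Codes.congr (hX : Codes 𝒦 w X P) (h : P = Q) : Codes 𝒦 w X Q := h ▸ hX

theorem codes_zero : Codes 𝒦 w 0 ∅ := ⟨Set.empty_subset _, fun j => by simp⟩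

theorem codes_singleton {σ : Finset (Fin n)} (hσ : σ ∈ 𝒦) :
    Codes 𝒦 w (1 <<< faceIndex w σ) {σ} := by
  refine ⟨Set.singleton_subset_iff.2 hσ, fun j => ?_⟩
  rw [Nat.one_shiftLeft, Nat.testBit_two_pow]
  simp

theorem Codes.eq_empty (hX : Codes 𝒦 w 0 P) : P = ∅ := by
  refine Set.eq_empty_iff_forall_notMem.2 fun σ hσ => ?_
  have := (hX.2 (faceIndex w σ)).2 ⟨σ, hσ, rfl⟩
  simp at this

/-! ### Operations on bit sets -/

/-- All faces of members of a family. A pair `d` consists of a weight and a mask. -/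
def closeBits (dirs : List (ℕ × ℕ)) (X : ℕ) : ℕ :=
  foldValue (fun X d => X ||| (X &&& d.2) >>> d.1) X dirs

/-- The mod 2 boundary of a chain. -/
def boundaryBits (dirs : List (ℕ × ℕ)) (X : ℕ) : ℕ :=
  foldValue (fun Y d => Y ^^^ (X &&& d.2) >>> d.1) 0 dirs

/-- The mod 2 coboundary of a cochain. -/
def coboundaryBits (dirs : List (ℕ × ℕ)) (B X : ℕ) : ℕ :=
  foldValue (fun Y d => Y ^^^ ((X <<< d.1) &&& d.2 &&& B)) 0 dirs

/-- The members with `k` elements. -/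
def layerBits (dirs : List (ℕ × ℕ)) (B : ℕ) : ℕ → ℕ
  | 0 => 1
  | k + 1 => withValue (layerBits dirs B k) fun L =>
    foldValue (fun Y d => Y ||| ((L <<< d.1) &&& d.2 &&& B)) 0 dirs

/-- The family `collapseAt v P`, where `d` is the weight and the mask of `v`. -/
def collapseBits (dirs : List (ℕ × ℕ)) (B : ℕ) (d : ℕ × ℕ) (X : ℕ) : ℕ :=
  withValue (X &&& d.2) fun S =>
  withValue (S >>> d.1) fun L =>
  withValue (X ^^^ S) fun R =>
  withValue (R ^^^ (R &&& L)) fun T =>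
  withValue (closeBits dirs T) fun D =>
  D ||| (((L &&& D) <<< d.1) &&& d.2 &&& B)

/-- The weights and masks of all vertices. -/
def directions (w M : Fin n → ℕ) : List (ℕ × ℕ) := (List.finRange n).map fun v => (w v, M v)

namespace IsFaceCode

theorem codes_closeBits (h : IsFaceCode 𝒦 w M B) (hX : Codes 𝒦 w X P) :
    Codes 𝒦 w (closeBits (directions w M) X) {σ | ∃ τ ∈ P, σ ⊆ τ} := by
  have key : ∀ (vs : List (Fin n)) (X : ℕ) (P : Set (Finset (Fin n))), Codes 𝒦 w X P →
      Codes 𝒦 w ((vs.map fun v => (w v, M v)).foldl (fun X d => X ||| (X &&& d.2) >>> d.1) X)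
        {σ | ∃ τ ∈ P, σ ⊆ τ ∧ ∀ v ∈ τ, v ∉ σ → v ∈ vs} := by
    intro vs
    induction vs with
    | nil =>
      intro X P hX
      refine hX.congr ?_
      symm
      ext σ
      constructor
      · rintro ⟨τ, hτ, h1, h2⟩
        have : σ = τ := h1.antisymm fun v hv => by_contra fun hc => by simpa using h2 v hv hc
        rwa [this]
      · exact fun hσ => ⟨σ, hσ, subset_rfl, fun v h1 h2 => absurd h1 h2⟩
    | cons u vs ih =>
      intro X P hX
      refine (ih _ _ (hX.union (h.codes_link hX u))).congr ?_
      symm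
      ext σ
      constructor
      · rintro ⟨τ, hτ, h1, h2⟩
        by_cases hu : u ∈ τ ∧ u ∉ σ
        · refine ⟨τ.erase u, Or.inr ⟨Finset.notMem_erase _ _, by rwa [Finset.insert_erase hu.1]⟩,
            Finset.subset_erase.2 ⟨h1, hu.2⟩, fun v hv hvσ => ?_⟩
          rw [Finset.mem_erase] at hv
          exact (List.mem_cons.1 (h2 v hv.2 hvσ)).resolve_left hv.1
        · refine ⟨τ, Or.inl hτ, h1, fun v hv hvσ => (List.mem_cons.1 (h2 v hv hvσ)).resolve_left ?_⟩
          rintro rfl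
          exact hu ⟨hv, hvσ⟩
      · rintro ⟨τ, hτ | hτ, h1, h2⟩
        · exact ⟨τ, hτ, h1, fun v hv hvσ => List.mem_cons_of_mem _ (h2 v hv hvσ)⟩
        · refine ⟨_, hτ.2, h1.trans (Finset.subset_insert _ _), fun v hv hvσ => ?_⟩
          rcases Finset.mem_insert.1 hv with rfl | hv
          · exact List.mem_cons_self
          · exact List.mem_cons_of_mem _ (h2 v hv hvσ)
  rw [closeBits, foldValue_eq]
  refine (key (List.finRange n) X P hX).congr ?_
  ext σ
  simp

theorem codes_collapseBits (h : IsFaceCode 𝒦 w M B) (hX : Codes 𝒦 w X P) (hP : IsLowerSet P)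
    (v : Fin n) :
    Codes 𝒦 w (collapseBits (directions w M) B (w v, M v) X) (collapseAt v P) := by
  have hS : Codes 𝒦 w (X &&& M v) {σ ∈ P | v ∈ σ} := by
    refine ⟨fun σ hσ => hX.1 hσ.1, fun j => ?_⟩
    rw [Nat.testBit_and, Bool.and_eq_true, hX.2]
    constructor
    · rintro ⟨⟨σ, hσ, rfl⟩, hj⟩
      exact ⟨σ, ⟨hσ, (h.testBit_mask σ (hX.1 hσ) v).1 hj⟩, rfl⟩
    · rintro ⟨σ, hσ, rfl⟩
      exact ⟨⟨σ, hσ.1, rfl⟩, (h.testBit_mask σ (hX.1 hσ.1) v).2 hσ.2⟩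
  have hL := h.codes_link hX v
  have hR := h.codes_xor hX hS (Set.sep_subset _ _)
  simp only [collapseBits, withValue_eq]
  have hD := h.codes_closeBits (h.codes_xor hR (h.codes_and hR hL) Set.inter_subset_left)
  refine (hD.union (h.codes_join (h.codes_and hL hD) v)).congr ?_
  symm
  ext σ
  constructor
  · rintro ⟨hσ, τ, h1, h2, h3, h4⟩
    have hτ : τ ∈ (P \ {σ ∈ P | v ∈ σ}) \ ((P \ {σ ∈ P | v ∈ σ}) ∩ {σ | v ∉ σ ∧ insert v σ ∈ P}) :=
      ⟨⟨h1, fun hc => h2 hc.2⟩, fun hc => h3 hc.2.2⟩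
    by_cases hv : v ∈ σ
    · right
      exact ⟨hX.1 hσ, hv, ⟨Finset.notMem_erase _ _, by rwa [Finset.insert_erase hv]⟩, τ, hτ, h4⟩
    · left
      rw [Finset.erase_eq_of_notMem hv] at h4
      exact ⟨τ, hτ, h4⟩
  · have hτ : ∀ τ, τ ∈ (P \ {σ ∈ P | v ∈ σ}) \
        ((P \ {σ ∈ P | v ∈ σ}) ∩ {σ | v ∉ σ ∧ insert v σ ∈ P}) →
        τ ∈ P ∧ v ∉ τ ∧ insert v τ ∉ P := by
      rintro τ ⟨⟨h1, h2⟩, h3⟩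
      have hv : v ∉ τ := fun hv => h2 ⟨h1, hv⟩
      exact ⟨h1, hv, fun hc => h3 ⟨⟨h1, h2⟩, hv, hc⟩⟩
    rintro (⟨τ, h1, h2⟩ | ⟨h0, hv, ⟨_, h1⟩, τ, h2, h3⟩)
    · obtain ⟨a, b, c⟩ := hτ τ h1
      exact ⟨hP h2 a, τ, a, b, c, (Finset.erase_subset _ _).trans h2⟩
    · obtain ⟨a, b, c⟩ := hτ τ h2
      rw [Finset.insert_erase hv] at h1
      exact ⟨h1, τ, a, b, c, h3⟩

theorem codes_layerBits (h : IsFaceCode 𝒦 w M B) (h0 : ∅ ∈ 𝒦) (k : ℕ) :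
    Codes 𝒦 w (layerBits (directions w M) B k) {σ ∈ 𝒦 | σ.card = k} := by
  induction k with
  | zero =>
    have := codes_singleton (w := w) h0
    rw [faceIndex_empty] at this
    refine this.congr ?_
    ext σ
    simp only [Set.mem_sep_iff, Finset.card_eq_zero, Set.mem_singleton_iff, iff_and_self]
    rintro rfl
    exact h0
  | succ k ih =>
    have key : ∀ (vs : List (Fin n)) (Y : ℕ) (Q : Set (Finset (Fin n))), Codes 𝒦 w Y Q →
        Codes 𝒦 w ((vs.map fun v => (w v, M v)).foldl (fun Y d => Y |||
            ((layerBits (directions w M) B k <<< d.1) &&& d.2 &&& B)) Y)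
          (Q ∪ {σ ∈ 𝒦 | σ.card = k + 1 ∧ ∃ v ∈ vs, v ∈ σ}) := by
      intro vs
      induction vs with
      | nil => intro Y Q hY; simpa using hY
      | cons u vs ihv =>
        intro Y Q hY
        refine (ihv _ _ (hY.union (h.codes_join ih u))).congr ?_
        symm
        rw [Set.union_assoc]
        congr 1
        ext σ
        constructor
        · rintro ⟨h1, h2, v, hv, hvσ⟩
          rcases List.mem_cons.1 hv with rfl | hv
          · exact Or.inl ⟨h1, hvσ, h.isLowerSet (Finset.erase_subset _ _) h1, by
              rw [Finset.card_erase_of_mem hvσ, h2]; rfl⟩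
          · exact Or.inr ⟨h1, h2, v, hv, hvσ⟩
        · rintro (⟨h1, h2, h3, h4⟩ | ⟨h1, h2, v, hv, hvσ⟩)
          · refine ⟨h1, ?_, u, List.mem_cons_self, h2⟩
            rw [← Finset.card_erase_add_one h2, h4]
          · exact ⟨h1, h2, v, List.mem_cons_of_mem _ hv, hvσ⟩
    rw [layerBits, withValue_eq, foldValue_eq]
    refine (key (List.finRange n) 0 ∅ codes_zero).congr ?_
    ext σ
    simp only [Set.mem_sep_iff, List.mem_finRange, true_and, Set.empty_union]
    refine and_congr_right fun _ => ⟨fun hc => hc.1, fun hc => ⟨hc, ?_⟩⟩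
    exact Finset.card_pos.1 (by omega)

end IsFaceCode

theorem foldl_xor_testBit (g : ℕ × ℕ → ℕ) (l : List (ℕ × ℕ)) (Y j : ℕ) :
    (if (l.foldl (fun Y d => Y ^^^ g d) Y).testBit j then (1 : ZMod 2) else 0) =
      (if Y.testBit j then 1 else 0) + (l.map fun d => if (g d).testBit j then 1 else 0).sum := by
  induction l generalizing Y with
  | nil => rw [List.map_nil, List.sum_nil, add_zero, List.foldl_nil]
  | cons d l ih =>
    rw [List.foldl_cons, ih, List.map_cons, List.sum_cons, Nat.testBit_xor, ← add_assoc]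
    congr 1
    cases Y.testBit j <;> cases (g d).testBit j <;> decide

open Classical in
theorem IsFaceCode.testBit_boundaryBits (h : IsFaceCode 𝒦 w M B) (hX : Codes 𝒦 w X P)
    {ρ : Finset (Fin n)} (hρ : ρ ∈ 𝒦) :
    (if (boundaryBits (directions w M) X).testBit (faceIndex w ρ) then (1 : ZMod 2) else 0) =
      ∑ v ∈ ρᶜ, if insert v ρ ∈ P then 1 else 0 := by
  rw [boundaryBits, foldValue_eq, foldl_xor_testBit, directions, List.map_map, ← Fin.sum_univ_def]
  simp only [Nat.zero_testBit, Function.comp_apply, h.testBit_iff (h.codes_link hX _) hρ]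
  rw [← Finset.sum_subset (Finset.subset_univ ρᶜ)]
  · simp only [Bool.false_eq_true, if_false, zero_add]
    refine Finset.sum_congr rfl fun v hv => if_congr ?_ rfl rfl
    exact ⟨fun hc => hc.2, fun hc => ⟨Finset.mem_compl.1 hv, hc⟩⟩
  · intro v _ hv
    exact if_neg fun hc => hv (Finset.mem_compl.2 hc.1)

open Classical in
theorem IsFaceCode.testBit_coboundaryBits (h : IsFaceCode 𝒦 w M B) (hX : Codes 𝒦 w X P)
    {τ : Finset (Fin n)} (hτ : τ ∈ 𝒦) :
    (if (coboundaryBits (directions w M) B X).testBit (faceIndex w τ) then (1 : ZMod 2) else 0) =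
      ∑ v ∈ τ, if τ.erase v ∈ P then 1 else 0 := by
  rw [coboundaryBits, foldValue_eq, foldl_xor_testBit, directions, List.map_map,
    ← Fin.sum_univ_def]
  simp only [Nat.zero_testBit, Function.comp_apply, h.testBit_iff (h.codes_join hX _) hτ]
  rw [← Finset.sum_subset (Finset.subset_univ τ)]
  · simp only [Bool.false_eq_true, if_false, zero_add]
    refine Finset.sum_congr rfl fun v hv => if_congr ?_ rfl rfl
    exact ⟨fun hc => hc.2.2, fun hc => ⟨hτ, hv, hc⟩⟩
  · intro v _ hv
    exact if_neg fun hc => hv hc.2.1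

end Bits

/-! ### Lists of faces and their bit sets -/

section Checks

/-- The index of a face given as a list of vertices, for the list `W` of weights. -/
def listIndex (W : List ℕ) (L : List ℕ) : ℕ := (L.map fun v => W.getD v 0).sum

/-- The bit set of those faces of the list `fs` that satisfy `p`. -/
def selectBits (W : List ℕ) (p : List ℕ → Bool) (fs : List (List ℕ)) : ℕ :=
  fs.foldr (fun L X => bif p L then 1 <<< listIndex W L ||| X else X) 0

/-- The masks `S` of the vertices, completed for the faces that arise by the removal of vertices in
the list `us`. -/
def extendMasks (W : List ℕ) : List ℕ → List ℕ → List ℕ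
  | [], S => S
  | u :: us, S =>
    withValues (S.zipIdx.map fun p =>
      bif p.2 == u then p.1 else p.1 ||| (p.1 &&& S.getD u 0) >>> W.getD u 0) (extendMasks W us)

/-- For each vertex, the bit set of the faces that contain it, in the complex with the list `fs` of
facets. -/
def vertexMasks (n : ℕ) (W : List ℕ) (fs : List (List ℕ)) : List ℕ :=
  withValues ((List.range n).map fun u => selectBits W (fun L => L.contains u) fs)
    (extendMasks W (List.range n))

/-- Whether `S` and `B` are the masks of the vertices and the bit set of all faces, for the complex
with the list `fs` of facets and the list `D` of weights and masks. The masks are right at the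
facets and remain so when a vertex `v` is removed, and a face in `B` that is not a facet arises by
the removal of a vertex. -/
def checkCode (n : ℕ) (W S : List ℕ) (D : List (ℕ × ℕ)) (B : ℕ) (fs : List (List ℕ)) : Bool :=
  B == foldValue (fun X d => X ||| (B &&& d.2) >>> d.1) (selectBits W (fun _ => true) fs) D &&
  (List.range n).all fun v =>
    withValue (W.getD v 0) fun w =>
    withValue (S.getD v 0) fun m =>
    withValue (B &&& m) fun Y =>
    withValue (Y >>> w) fun Z =>
    withValue (selectBits W (fun L => L.contains v) fs) fun F =>
    Nat.blt 0 w && (F &&& m == F) && (selectBits W (fun L => !L.contains v) fs &&& m == 0) &&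
      (Z &&& m == 0) &&
      (List.range n).all fun u => u == v || (Y &&& S.getD u 0) >>> w == Z &&& S.getD u 0

theorem testBit_selectBits (W : List ℕ) (p : List ℕ → Bool) (fs : List (List ℕ)) (j : ℕ) :
    (selectBits W p fs).testBit j = true ↔ ∃ L ∈ fs, p L = true ∧ listIndex W L = j := by
  induction fs with
  | nil => simp [selectBits]
  | cons L fs ih =>
    rw [selectBits, List.foldr_cons]
    rw [selectBits] at ih
    cases hp : p L
    · rw [cond_false, ih]
      simp [hp]
    · rw [cond_true, Nat.testBit_or, Bool.or_eq_true, ih, Nat.one_shiftLeft, Nat.testBit_two_pow]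
      simp [hp]

theorem listIndex_map_val {n : ℕ} (W : List ℕ) {l : List (Fin n)} (hl : l.Nodup) :
    listIndex W (l.map Fin.val) = faceIndex (fun v : Fin n => W.getD v 0) l.toFinset := by
  rw [listIndex, faceIndex, List.sum_toFinset _ hl, List.map_map]
  rfl

theorem testBit_foldl_or (g : ℕ × ℕ → ℕ) (l : List (ℕ × ℕ)) (X j : ℕ) :
    (l.foldl (fun X d => X ||| g d) X).testBit j = true ↔
      X.testBit j = true ∨ ∃ d ∈ l, (g d).testBit j = true := by
  induction l generalizing X with
  | nil => simp
  | cons d l ih => simp [ih, or_assoc]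

theorem isFaceCode_of_check {n : ℕ} {W S : List ℕ} {B : ℕ} {fs : List (List (Fin n))}
    (hfs : ∀ l ∈ fs, l.Nodup) (h : checkCode n W S
      (directions (n := n) (fun v => W.getD v 0) fun v => S.getD v 0) B
      (fs.map (List.map Fin.val)) = true) :
    IsFaceCode {σ : Finset (Fin n) | ∃ l ∈ fs, σ ⊆ l.toFinset} (fun v => W.getD v 0)
      (fun v => S.getD v 0) B := by
  simp only [checkCode, foldValue_eq, withValue_eq, Bool.and_eq_true, List.all_eq_true,
    List.mem_range, beq_iff_eq, Bool.or_eq_true, Nat.blt_eq] at h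
  obtain ⟨hB, h⟩ := h
  have bit : ∀ {X Y : ℕ}, X = Y → ∀ j, X.testBit j = true → Y.testBit j = true := by
    rintro X _ rfl j hj
    exact hj
  set w : Fin n → ℕ := fun v => W.getD v 0 with hw
  set M : Fin n → ℕ := fun v => S.getD v 0 with hM
  have hB' : ∀ j, B.testBit j = true ↔
      (selectBits W (fun _ => true) (fs.map (List.map Fin.val))).testBit j = true ∨
        ∃ d ∈ directions w M, ((B &&& d.2) >>> d.1).testBit j = true := by
    intro j
    conv_lhs => rw [hB]
    exact testBit_foldl_or _ _ _ j
  have hcontains : ∀ (l : List (Fin n)) (v : Fin n),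
      (l.map Fin.val).contains (v : ℕ) = true ↔ v ∈ l := by
    intro l v
    rw [List.contains_iff_mem, List.mem_map]
    exact ⟨fun ⟨u, hu, e⟩ => Fin.ext e ▸ hu, fun hv => ⟨v, hv, rfl⟩⟩
  have hfacet : ∀ l ∈ fs, B.testBit (faceIndex w l.toFinset) = true ∧
      ∀ v, (M v).testBit (faceIndex w l.toFinset) = true ↔ v ∈ l.toFinset := by
    intro l hl
    have hi := listIndex_map_val W (hfs l hl)
    refine ⟨(hB' _).2 (Or.inl ?_), fun v => ⟨fun hv => ?_, fun hv => ?_⟩⟩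
    · exact (testBit_selectBits _ _ _ _).2 ⟨_, List.mem_map_of_mem hl, rfl, hi⟩
    · by_contra hc
      rw [List.mem_toFinset, ← hcontains] at hc
      have := bit (h v v.2).1.1.2 (faceIndex w l.toFinset) (by
        rw [Nat.testBit_and, Bool.and_eq_true]
        exact ⟨(testBit_selectBits _ _ _ _).2 ⟨_, List.mem_map_of_mem hl, by simpa using hc, hi⟩,
          hv⟩)
      simp at this
    · rw [List.mem_toFinset, ← hcontains] at hv
      have := bit (h v v.2).1.1.1.2.symm (faceIndex w l.toFinset)
        ((testBit_selectBits _ _ _ _).2 ⟨_, List.mem_map_of_mem hl, hv, hi⟩)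
      rw [Nat.testBit_and, Bool.and_eq_true] at this
      exact this.2
  have herase : ∀ (τ : Finset (Fin n)) (v : Fin n), v ∈ τ →
      (B.testBit (faceIndex w τ) = true ∧ ∀ u, (M u).testBit (faceIndex w τ) = true ↔ u ∈ τ) →
      B.testBit (faceIndex w (τ.erase v)) = true ∧
        ∀ u, (M u).testBit (faceIndex w (τ.erase v)) = true ↔ u ∈ τ.erase v := by
    intro τ v hv ⟨h1, h2⟩
    have hidx : w v + faceIndex w (τ.erase v) = faceIndex w τ := by
      rw [add_comm, faceIndex_erase_add hv]
    have hZ : ((B &&& M v) >>> w v).testBit (faceIndex w (τ.erase v)) = true := by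
      rw [Nat.testBit_shiftRight, hidx, Nat.testBit_and, h1, (h2 v).2 hv]
      rfl
    refine ⟨(hB' _).2 (Or.inr ⟨(w v, M v), List.mem_map_of_mem (List.mem_finRange v), hZ⟩),
      fun u => ?_⟩
    by_cases huv : u = v
    · subst huv
      refine iff_of_false (fun hc => ?_) (Finset.notMem_erase _ _)
      have := bit (h u u.2).1.2 (faceIndex w (τ.erase u)) (by
        rw [Nat.testBit_and, Bool.and_eq_true]
        exact ⟨hZ, hc⟩)
      simp at this
    · have hc := ((h v v.2).2 u u.2).resolve_left fun e => huv (Fin.ext e)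
      have hc := congrArg (fun X => X.testBit (faceIndex w (τ.erase v))) hc
      simp only [Nat.testBit_shiftRight, Nat.testBit_and] at hc hZ
      rw [hZ, Bool.true_and, Bool.true_and] at hc
      rw [Finset.mem_erase, ← h2 u, ← hidx]
      change (S.getD u 0).testBit _ = true ↔ u ≠ v ∧ (S.getD u 0).testBit _ = true
      rw [← hc]
      exact ⟨fun hu => ⟨huv, hu⟩, fun hu => hu.2⟩
  have hall : ∀ l ∈ fs, ∀ σ ⊆ l.toFinset, B.testBit (faceIndex w σ) = true ∧
      ∀ u, (M u).testBit (faceIndex w σ) = true ↔ u ∈ σ := by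
    intro l hl σ hσ
    have key : ∀ T : Finset (Fin n), B.testBit (faceIndex w (l.toFinset \ T)) = true ∧
        ∀ u, (M u).testBit (faceIndex w (l.toFinset \ T)) = true ↔ u ∈ l.toFinset \ T := by
      intro T
      induction T using Finset.induction_on with
      | empty => rw [Finset.sdiff_empty]; exact hfacet l hl
      | insert a T _ ih =>
        rw [Finset.sdiff_insert]
        by_cases ha : a ∈ l.toFinset \ T
        · exact herase _ a ha ih
        · rwa [Finset.erase_eq_of_notMem ha]
    have := key (l.toFinset \ σ)
    rwa [Finset.sdiff_sdiff_eq_self hσ] at this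
  refine ⟨fun σ ρ hρ ⟨l, hl, hσ⟩ => ⟨l, hl, hρ.trans hσ⟩, fun σ ⟨l, hl, hσ⟩ => (hall l hl σ hσ).2,
    fun j => ⟨fun hj => ?_, fun ⟨σ, ⟨l, hl, hσ⟩, e⟩ => e ▸ (hall l hl σ hσ).1⟩⟩
  -- The face with a vertex more has a larger index, and all indices are below `B`.
  induction hk : B - j using Nat.strong_induction_on generalizing j with
  | _ k ih =>
  rcases (hB' j).1 hj with hj | ⟨d, hd, hj⟩
  · obtain ⟨L, hL, _, hLj⟩ := (testBit_selectBits _ _ _ _).1 hj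
    obtain ⟨l, hl, rfl⟩ := List.mem_map.1 hL
    exact ⟨l.toFinset, ⟨l, hl, subset_rfl⟩, by rw [← hLj, listIndex_map_val W (hfs l hl)]⟩
  · obtain ⟨v, _, rfl⟩ := List.mem_map.1 hd
    rw [Nat.testBit_shiftRight, Nat.testBit_and, Bool.and_eq_true] at hj
    have hpos : 0 < w v := (h v v.2).1.1.1.1
    have hlt : w v + j < B :=
      Nat.lt_of_lt_of_le Nat.lt_two_pow_self (Nat.ge_two_pow_of_testBit hj.1)
    obtain ⟨τ, ⟨l, hl, hτ⟩, e⟩ := ih (B - (w v + j)) (by omega) _ hj.1 rfl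
    have hv : v ∈ τ := ((hall l hl τ hτ).2 v).1 (by rw [e]; exact hj.2)
    refine ⟨τ.erase v, ⟨l, hl, (Finset.erase_subset _ _).trans hτ⟩, ?_⟩
    have := faceIndex_erase_add (w := w) hv
    omega

/-! ### Checking a sequence of collapses -/

/-- A step of the reduction of a complex: a collapse at a vertex, or the removal of a maximal face,
which becomes critical. -/
inductive ReductionStep
  | collapse (v : ℕ)
  | critical (σ : List ℕ)

/-- Whether the steps reduce the bit set `X` to the empty family. -/
def checkSteps (n : ℕ) (W S : List ℕ) (D : List (ℕ × ℕ)) (B : ℕ) : List ReductionStep → ℕ → Bool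
  | [], X => X == 0
  | .collapse v :: s, X =>
    Nat.blt v n &&
      withValue (collapseBits D B (W.getD v 0, S.getD v 0) X) fun X => checkSteps n W S D B s X
  | .critical L :: s, X =>
    withValue (listIndex W L) fun j =>
    X.testBit j && (layerBits D B L.length).testBit j &&
      (D.all fun d => !((X &&& d.2) >>> d.1).testBit j) &&
      withValue (X ^^^ 1 <<< j) fun X => checkSteps n W S D B s X

/-- The sizes of the critical faces. -/
def criticalSizes : List ReductionStep → List ℕ
  | [] => []
  | .collapse _ :: s => criticalSizes s
  | .critical L :: s => L.length :: criticalSizes s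

theorem exists_isGradient_of_check {n : ℕ} {𝒦 : Set (Finset (Fin n))} {W S : List ℕ} {B : ℕ}
    (h : IsFaceCode 𝒦 (fun v => W.getD v 0) (fun v => S.getD v 0) B) (h0 : ∅ ∈ 𝒦)
    {s : List ReductionStep} {X : ℕ} {P : Set (Finset (Fin n))}
    (hX : Codes 𝒦 (fun v => W.getD v 0) X P) (hP : IsLowerSet P)
    (hs : checkSteps n W S (directions (n := n) (fun v => W.getD v 0) fun v => S.getD v 0) B s X =
      true) :
    ∃ C f m, IsGradient P C f m ∧ C.map Finset.card = criticalSizes s := by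
  induction s generalizing X P with
  | nil =>
    simp only [checkSteps, beq_iff_eq] at hs
    subst hs
    rw [hX.eq_empty]
    exact ⟨[], fun _ => 0, id, ⟨by simp, by simp⟩, rfl⟩
  | cons a s ih =>
    cases a with
    | collapse v =>
      rw [checkSteps, withValue_eq, Bool.and_eq_true, Nat.blt_eq] at hs
      obtain ⟨C, f, m, hf, hC⟩ := ih (h.codes_collapseBits hX hP ⟨v, hs.1⟩)
        (isLowerSet_collapseAt hP) hs.2
      obtain ⟨f', m', hf'⟩ := hf.of_collapseAt hP
      exact ⟨C, f', m', hf', hC⟩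
    | critical L =>
      simp only [checkSteps, withValue_eq, Bool.and_eq_true, List.all_eq_true] at hs
      obtain ⟨⟨⟨h1, h2⟩, h3⟩, h4⟩ := hs
      obtain ⟨σ, ⟨hσ, hcard⟩, hσj⟩ := ((h.codes_layerBits h0 _).2 _).1 h2
      rw [← hσj] at h1 h3 h4
      rw [h.testBit_iff hX hσ] at h1
      have hmax : ∀ v, v ∉ σ → insert v σ ∉ P := by
        intro v hv hc
        have := h3 _ (List.mem_map_of_mem (List.mem_finRange v))
        rw [(h.testBit_iff (h.codes_link hX v) hσ).2 ⟨hv, hc⟩] at this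
        exact absurd this (by decide)
      have hlow : IsLowerSet (P \ {σ}) := by
        rintro τ ρ hρ ⟨hτ, hne⟩
        refine ⟨hP hρ hτ, ?_⟩
        rintro rfl
        obtain ⟨v, hv, hvρ⟩ := Finset.exists_of_ssubset (lt_of_le_of_ne hρ (Ne.symm hne))
        exact hmax v hvρ (hP (Finset.insert_subset hv hρ) hτ)
      obtain ⟨C, f, m, hf, hC⟩ := ih (h.codes_xor hX (codes_singleton hσ)
        (Set.singleton_subset_iff.2 h1)) hlow h4
      obtain ⟨f', m', hf'⟩ := hf.insert_face (σ := σ) (fun hc => hc.2 rfl) (by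
        rintro τ ⟨hτ, _⟩ hc
        obtain ⟨v, hv, rfl⟩ := (Finset.covBy_iff_exists_insert).1 hc
        exact hmax v hv hτ)
      rw [Set.insert_sdiff_singleton, Set.insert_eq_of_mem h1] at hf'
      exact ⟨σ :: C, f', m', hf', by rw [List.map_cons, hC, hcard, criticalSizes]⟩

/-! ### Checking cycles and cocycles -/

/-- Whether `z` is an `i`-cycle, `φ` an `i`-cocycle, and both have just one face in common, so that
their intersection is a power of two. The bit at `0` belongs to the empty set, which the boundary of
a vertex disregards. -/
def checkCycle (D : List (ℕ × ℕ)) (B i z φ : ℕ) : Bool :=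
  withValue z fun z =>
  withValue φ fun φ =>
  withValue (layerBits D B (i + 1)) fun N =>
  withValue (z &&& φ) fun y =>
  (z &&& N == z) && (φ &&& N == φ) && (boundaryBits D z >>> 1 == 0) &&
    (coboundaryBits D B φ == 0) && (y != 0 && y &&& (y - 1) == 0)

theorem exists_isCriticalFace_of_check {n : ℕ} {K : PreAbstractSimplicialComplex (Fin n)}
    {W S : List ℕ} {B : ℕ}
    (h : IsFaceCode (insert ∅ K.faces) (fun v => W.getD v 0) (fun v => S.getD v 0) B)
    (hW : ∀ v : Fin n, 0 < W.getD v 0) {i z φ : ℕ} (hc : checkCycle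
      (directions (n := n) (fun v => W.getD v 0) fun v => S.getD v 0) B i z φ = true)
    {f : Finset (Fin n) → ℝ} (hf : IsDiscreteMorse K f) :
    ∃ σ, IsCriticalFace K f σ ∧ σ.card = i + 1 := by
  classical
  simp only [checkCycle, withValue_eq, Bool.and_eq_true, beq_iff_eq, bne_iff_ne,
    Nat.ne_zero_and_sub_one_eq_zero_iff_isPowerOfTwo] at hc
  obtain ⟨⟨⟨⟨hz, hφ⟩, hbd⟩, hcob⟩, e, hy⟩ := hc
  have h0 : ∅ ∈ insert ∅ K.faces := Or.inl rfl
  have hN := h.codes_layerBits h0 (i + 1)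
  have sub : ∀ {x N : ℕ}, x &&& N = x → ∀ {j}, x.testBit j = true → N.testBit j = true := by
    intro x N e j hj
    rw [← e, Nat.testBit_and, Bool.and_eq_true] at hj
    exact hj.2
  have code : ∀ {x : ℕ}, x &&& layerBits (directions (n := n) (fun v => W.getD v 0)
      fun v => S.getD v 0) B (i + 1) = x → Codes (insert ∅ K.faces) (fun v => W.getD v 0) x
        {σ ∈ insert ∅ K.faces | σ.card = i + 1 ∧
          x.testBit (faceIndex (fun v : Fin n => W.getD v 0) σ) = true} := by
    intro x hx
    refine ⟨Set.sep_subset _ _, fun j => ⟨fun hj => ?_, ?_⟩⟩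
    · obtain ⟨σ, ⟨h1, h2⟩, rfl⟩ := (hN.2 j).1 (sub hx hj)
      exact ⟨σ, ⟨h1, h2, hj⟩, rfl⟩
    · rintro ⟨σ, hσ, rfl⟩
      exact hσ.2.2
  have hzC := code hz
  have hφC := code hφ
  set Z := {σ ∈ insert ∅ K.faces | σ.card = i + 1 ∧
    z.testBit (faceIndex (fun v : Fin n => W.getD v 0) σ) = true} with hZ
  set Φ := {σ ∈ insert ∅ K.faces | σ.card = i + 1 ∧
    φ.testBit (faceIndex (fun v : Fin n => W.getD v 0) σ) = true} with hΦ
  have hmemK : ∀ σ ∈ insert ∅ K.faces, σ.card = i + 1 → σ ∈ K := by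
    rintro σ (rfl | hσ) hcard
    · simp at hcard
    · exact hσ
  by_contra hno
  push Not at hno
  have hsum := sum_mul_eq_zero_of_no_critical hf hno (φ := fun σ => if σ ∈ Φ then 1 else 0) ?_
    (fun σ => if σ ∈ Z then 1 else 0) ?_ ?_
  · have hyC := h.codes_and hzC hφC
    rw [hy] at hyC
    obtain ⟨σ, hσ, hσj⟩ := (hyC.2 e).1 (by rw [Nat.testBit_two_pow]; simp)
    rw [Finset.sum_eq_single σ] at hsum
    · simp only [if_pos hσ.1, if_pos hσ.2] at hsum
      exact absurd hsum (by decide)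
    · intro τ _ hne
      by_cases hτ : τ ∈ Z ∩ Φ
      · exfalso
        have hj := (hyC.2 (faceIndex (fun v : Fin n => W.getD v 0) τ)).2 ⟨τ, hτ, rfl⟩
        rw [Nat.testBit_two_pow, decide_eq_true_eq] at hj
        exact hne (h.injOn (hyC.1 hτ) (hyC.1 hσ) (hj.symm.trans hσj.symm))
      · by_cases h1 : τ ∈ Z
        · rw [if_neg fun h2 => hτ ⟨h1, h2⟩, mul_zero]
        · rw [if_neg h1, zero_mul]
    · exact fun hc => absurd (Finset.mem_univ σ) hc
  · intro τ hτ _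
    have e := h.testBit_coboundaryBits hφC (Or.inr hτ)
    rw [hcob, Nat.zero_testBit, if_neg (by decide)] at e
    convert e.symm
  · intro σ hσ
    have : σ ∈ Z := by by_contra hc; exact hσ (if_neg hc)
    exact ⟨hmemK σ this.1 this.2.1, this.2.1⟩
  · intro ρ hρ
    have e := h.testBit_boundaryBits hzC (Or.inr hρ)
    obtain ⟨v, hv⟩ := (K.isRelLowerSet_faces hρ).1
    obtain ⟨k, hk⟩ : ∃ k, faceIndex (fun v : Fin n => W.getD v 0) ρ = 1 + k := by
      have := faceIndex_erase_add (w := fun v : Fin n => W.getD v 0) hv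
      have hpos := hW v
      exact ⟨_, (Nat.add_sub_cancel' (by omega)).symm⟩
    rw [hk, ← Nat.testBit_shiftRight, hbd, Nat.zero_testBit, if_neg (by decide)] at e
    convert e.symm

end Checks

/-! ### Facets of an orbit complex -/

section Orbit

variable {n : ℕ}

/-- The values of a permutation. -/
def permTable (g : Equiv.Perm (Fin n)) : List ℕ := (List.finRange n).map fun i => (g i : ℕ)

/-- The element of the group generated by `g` and `h` that a word stands for, with `true` for `h`.
-/
def wordPerm (g h : Equiv.Perm (Fin n)) (x : List Bool) : Equiv.Perm (Fin n) :=
  (x.map fun c => bif c then h else g).prod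

/-- The values of the permutation that a word stands for, from the tables `a` and `b` of the
generators. -/
def wordTable (n : ℕ) (a b : List ℕ) (x : List Bool) : List ℕ :=
  x.foldr (fun c t => t.map fun i => (bif c then b else a).getD i 0) (List.range n)

/-- Whether the words stand for all elements of the group: the identity is among them, and left
multiplication by a generator does not lead out of them. -/
def checkWords (n : ℕ) (a b : List ℕ) (words : List (List Bool)) : Bool :=
  withValues a fun a =>
  withValues b fun b =>
  withLists (words.map (wordTable n a b)) fun T =>
  words.contains [] && words.all fun x =>
    T.contains (wordTable n a b (false :: x)) && T.contains (wordTable n a b (true :: x))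

/-- The images of the sets in `reps` under the permutations that the words stand for. -/
def orbitFacets (n : ℕ) (a b : List ℕ) (words : List (List Bool)) (reps : List (Finset (Fin n))) :
    List (List ℕ) :=
  withValues a fun a =>
  withValues b fun b =>
  words.flatMap fun x => withValues (wordTable n a b x) fun t => reps.map fun F =>
    ((List.finRange n).filter fun v => decide (v ∈ F)).map fun v : Fin n => t.getD v 0

theorem permTable_getD (g : Equiv.Perm (Fin n)) (i : Fin n) : (permTable g).getD i 0 = g i := by
  simp [permTable, List.getD]

theorem permTable_injective : Function.Injective (permTable (n := n)) := by
  intro g h e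
  ext i
  rw [← permTable_getD, e, permTable_getD]

theorem wordTable_eq (g h : Equiv.Perm (Fin n)) (x : List Bool) :
    wordTable n (permTable g) (permTable h) x = permTable (wordPerm g h x) := by
  induction x with
  | nil =>
    refine List.ext_getElem (by simp [wordTable, permTable]) fun i _ _ => ?_
    simp [wordTable, wordPerm, permTable]
  | cons c x ih =>
    rw [wordTable, List.foldr_cons]
    rw [wordTable] at ih
    rw [ih, wordPerm, wordPerm, List.map_cons, List.prod_cons]
    change List.map _ (List.map _ (List.finRange n)) = List.map _ (List.finRange n)
    rw [List.map_map]
    refine List.map_congr_left fun i _ => ?_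
    cases c
    · exact permTable_getD g _
    · exact permTable_getD h _

theorem exists_word_of_mem_closure {g h : Equiv.Perm (Fin n)} {words : List (List Bool)}
    (hc : checkWords n (permTable g) (permTable h) words = true) (p : Equiv.Perm (Fin n)) :
    p ∈ Subgroup.closure {g, h} ↔ ∃ x ∈ words, wordPerm g h x = p := by
  simp only [checkWords, withValues_eq, withLists_eq, Bool.and_eq_true, List.all_eq_true,
    List.contains_iff_mem, List.mem_map] at hc
  obtain ⟨h1, hmul⟩ := hc
  have step : ∀ c : Bool, ∀ x ∈ words, ∃ y ∈ words,
      wordPerm g h y = (bif c then h else g) * wordPerm g h x := by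
    intro c x hx
    have : ∃ y ∈ words, wordTable n (permTable g) (permTable h) y =
        wordTable n (permTable g) (permTable h) (c :: x) := by
      cases c
      exacts [(hmul x hx).1, (hmul x hx).2]
    obtain ⟨y, hy, e⟩ := this
    rw [wordTable_eq, wordTable_eq] at e
    exact ⟨y, hy, permTable_injective e⟩
  constructor
  · intro hp
    rw [← Subgroup.mem_toSubmonoid, Subgroup.closure_toSubmonoid_of_finite] at hp
    induction hp using Submonoid.closure_induction_left with
    | one => exact ⟨[], h1, rfl⟩
    | mul_left q hq r _ ih =>
      obtain ⟨x, hx, rfl⟩ := ih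
      rcases hq with rfl | rfl
      · exact step false x hx
      · exact step true x hx
  · rintro ⟨x, _, rfl⟩
    refine Subgroup.list_prod_mem _ fun q hq => ?_
    obtain ⟨c, _, rfl⟩ := List.mem_map.1 hq
    cases c
    · exact Subgroup.subset_closure (Or.inl rfl)
    · exact Subgroup.subset_closure (Or.inr rfl)

/-- The facets computed from tables are duplicate-free lists of vertices, and they generate the
orbit complex. -/
theorem exists_facets_of_check {g h : Equiv.Perm (Fin n)} {words : List (List Bool)}
    (hc : checkWords n (permTable g) (permTable h) words = true) (reps : List (Finset (Fin n))) :
    ∃ fs : List (List (Fin n)), (∀ l ∈ fs, l.Nodup) ∧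
      fs.map (List.map Fin.val) = orbitFacets n (permTable g) (permTable h) words reps ∧
      ∀ σ : Finset (Fin n), σ.Nonempty →
        ((∃ l ∈ fs, σ ⊆ l.toFinset) ↔ σ ∈ orbitComplex {g, h} reps) := by
  refine ⟨words.flatMap fun x => reps.map fun F =>
    ((List.finRange n).filter fun v => decide (v ∈ F)).map (wordPerm g h x), ?_, ?_, ?_⟩
  · intro l hl
    obtain ⟨x, _, hl⟩ := List.mem_flatMap.1 hl
    obtain ⟨F, _, rfl⟩ := List.mem_map.1 hl
    exact ((List.nodup_finRange n).filter _).map (wordPerm g h x).injective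
  · simp only [orbitFacets, withValues_eq, List.map_flatMap, List.map_map]
    refine List.flatMap_congr fun x _ => List.map_congr_left fun F _ => ?_
    simp only [Function.comp_apply, List.map_map, wordTable_eq, permTable_getD]
    rfl
  · intro σ hσ
    have key : ∀ (x : List Bool) (F : Finset (Fin n)),
        (((List.finRange n).filter fun v => decide (v ∈ F)).map
          (wordPerm g h x)).toFinset = F.map (wordPerm g h x).toEmbedding := by
      intro x F
      ext v
      simp only [List.mem_toFinset, List.mem_map, List.mem_filter, List.mem_finRange, true_and,
        decide_eq_true_eq, Finset.mem_map, Equiv.coe_toEmbedding]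
    constructor
    · rintro ⟨l, hl, hs⟩
      obtain ⟨x, hx, hl⟩ := List.mem_flatMap.1 hl
      obtain ⟨F, hF, rfl⟩ := List.mem_map.1 hl
      exact ⟨hσ, _, (exists_word_of_mem_closure hc _).2 ⟨x, hx, rfl⟩, F, hF, by rwa [key] at hs⟩
    · rintro ⟨_, p, hp, F, hF, hs⟩
      obtain ⟨x, hx, rfl⟩ := (exists_word_of_mem_closure hc _).1 hp
      exact ⟨_, List.mem_flatMap.2 ⟨x, hx, List.mem_map_of_mem hF⟩, by rwa [key]⟩

end Orbit

/-! ### The optimal discrete Morse vector -/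

section Optimal

theorem ncard_setOf_mem_card_le {V : Type*} (l : List (Finset V)) (k : ℕ) :
    {σ | σ ∈ l ∧ σ.card = k}.ncard ≤ (l.map Finset.card).count k := by
  classical
  have h : {σ | σ ∈ l ∧ σ.card = k} =
      ((l.filter fun σ => σ.card == k).toFinset : Set (Finset V)) := by
    ext σ
    simp
  rw [h, Set.ncard_coe_finset, List.count, List.countP_map, List.countP_eq_length_filter]
  exact List.toFinset_card_le _

/-- If every discrete Morse vector is at least `v` in each entry, and one of them is at most `v`,
then only `v` has the least sum. -/
theorem isOptimalMorseVector_iff {V : Type*} [Finite V] {K : PreAbstractSimplicialComplex V}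
    {v : List ℕ} (hv : v.length = complexDim K + 1) {f : Finset V → ℝ} (hf : IsDiscreteMorse K f)
    (hle : ∀ i < v.length, {σ | IsCriticalFace K f σ ∧ σ.card = i + 1}.ncard ≤ v.getD i 0)
    (hge : ∀ g, IsDiscreteMorse K g → ∀ i < v.length,
      v.getD i 0 ≤ {σ | IsCriticalFace K g σ ∧ σ.card = i + 1}.ncard) (u : List ℕ) :
    IsOptimalMorseVector K u ↔ u = v := by
  set c : (Finset V → ℝ) → ℕ → ℕ :=
    fun g i => {σ | IsCriticalFace K g σ ∧ σ.card = i + 1}.ncard with hc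
  have hvec : ∀ g, morseVector K g = (List.range v.length).map (c g) := fun g => by rw [hv]; rfl
  have hv' : v = (List.range v.length).map fun i => v.getD i 0 := by
    refine List.ext_getElem (by simp) fun i h1 h2 => ?_
    simp [h1]
  have hsum : ∀ p : ℕ → ℕ, ((List.range v.length).map p).sum = ∑ i ∈ Finset.range v.length, p i :=
    fun _ => rfl
  have eq_of : ∀ g, (∀ i < v.length, c g i = v.getD i 0) → morseVector K g = v := by
    intro g hg
    rw [hvec]
    exact (List.map_congr_left fun i hi => hg i (List.mem_range.1 hi)).trans hv'.symm
  have hfv : morseVector K f = v := eq_of f fun i hi => (hle i hi).antisymm (hge f hf i hi)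
  have hvsum : v.sum = ∑ i ∈ Finset.range v.length, v.getD i 0 := by
    conv_lhs => rw [hv', hsum]
  constructor
  · rintro ⟨⟨g, hg, rfl⟩, hmin⟩
    have h1 := hmin f hf
    rw [hfv, hvsum, hvec, hsum] at h1
    have hge' : ∀ i ∈ Finset.range v.length, v.getD i 0 ≤ c g i :=
      fun i hi => hge g hg i (Finset.mem_range.1 hi)
    have h2 := (Finset.sum_eq_sum_iff_of_le hge').1 ((Finset.sum_le_sum hge').antisymm h1)
    exact eq_of g fun i hi => (h2 i (Finset.mem_range.2 hi)).symm
  · rintro rfl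
    refine ⟨⟨f, hf, hfv⟩, fun g hg => ?_⟩
    rw [hvsum, hvec, hsum]
    exact Finset.sum_le_sum fun i hi => hge g hg i (Finset.mem_range.1 hi)

/-- Whether `v` is the only optimal discrete Morse vector of the complex with the list `fs` of
facets. The steps have to reduce the complex to nothing, with `v` counting their critical faces and
the vertex that the last collapse pairs with the empty set. For each entry `1` of `v` a cycle and a
cocycle that meet in one face have to be given, except that the cycle in the top dimension consists
of all facets, and the cocycle in dimension zero of all vertices. -/
def checkMorseVector (n : ℕ) (W : List ℕ) (fs : List (List ℕ)) (steps : List ReductionStep)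
    (v : List ℕ) (cycles cocycles : List (List (List ℕ))) : Bool :=
  withLists fs fun fs =>
  withValues W fun W =>
  withValues (vertexMasks n W fs) fun S =>
  withPairs (directions (n := n) (fun v => W.getD v 0) fun v => S.getD v 0) fun D =>
  withValue (closeBits D (selectBits W (fun _ => true) fs)) fun B =>
  checkCode n W S D B fs && checkSteps n W S D B steps B && B.testBit 0 &&
    (layerBits D B v.length != 0) && (layerBits D B (v.length + 1) == 0) && Nat.blt 0 v.length &&
    (List.range v.length).all fun i =>
      (1 :: criticalSizes steps).count (i + 1) == v.getD i 0 &&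
      (v.getD i 0 == 0 || v.getD i 0 == 1 && checkCycle D B i
        (bif i + 1 == v.length then layerBits D B v.length
          else selectBits W (fun _ => true) (cycles.getD i []))
        (bif i == 0 then layerBits D B 1 else selectBits W (fun _ => true) (cocycles.getD i [])))

theorem isOptimalMorseVector_orbitComplex {n : ℕ} {g h : Equiv.Perm (Fin n)}
    {reps : List (Finset (Fin n))} (words : List (List Bool))
    (hwords : checkWords n (permTable g) (permTable h) words = true) (W : List ℕ)
    (steps : List ReductionStep) (v : List ℕ) (cycles cocycles : List (List (List ℕ)))
    (hc : checkMorseVector n W (orbitFacets n (permTable g) (permTable h) words reps) steps v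
      cycles cocycles = true) (u : List ℕ) :
    IsOptimalMorseVector (orbitComplex {g, h} reps) u ↔ u = v := by
  obtain ⟨fs, hnd, hfs, hK⟩ := exists_facets_of_check hwords reps
  rw [← hfs] at hc
  set K := orbitComplex {g, h} reps with hKdef
  simp only [checkMorseVector, withLists_eq, withValues_eq, withPairs_eq, withValue_eq,
    Bool.and_eq_true, List.all_eq_true, List.mem_range, beq_iff_eq, Bool.or_eq_true, Nat.blt_eq,
    bne_iff_ne] at hc
  obtain ⟨⟨⟨⟨⟨⟨hcode, hsteps⟩, hB0⟩, htop⟩, hover⟩, hpos⟩, hv⟩ := hc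
  have hW : ∀ u : Fin n, 0 < W.getD u 0 := by
    intro u
    simp only [checkCode, withValue_eq, Bool.and_eq_true, List.all_eq_true, List.mem_range,
      Nat.blt_eq] at hcode
    exact (hcode.2 u u.2).1.1.1.1
  have code := isFaceCode_of_check hnd hcode
  obtain ⟨σ₀, ⟨l₀, hl₀, _⟩, _⟩ := (code.testBit_all 0).1 hB0
  have hset : {σ : Finset (Fin n) | ∃ l ∈ fs, σ ⊆ l.toFinset} = insert ∅ K.faces := by
    ext σ
    rcases σ.eq_empty_or_nonempty with rfl | hσ
    · exact iff_of_true ⟨l₀, hl₀, Finset.empty_subset _⟩ (Or.inl rfl)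
    · exact (hK σ hσ).trans ⟨Or.inr, fun h => h.resolve_left hσ.ne_empty⟩
  rw [hset] at code
  have h0 : ∅ ∈ insert ∅ K.faces := Or.inl rfl
  have hdim : v.length = complexDim K + 1 := by
    have hgreatest : IsGreatest {i | ∃ σ ∈ K, σ.card = i + 1} (v.length - 1) := by
      constructor
      · obtain ⟨j, hj⟩ := Nat.exists_testBit_of_ne_zero htop
        obtain ⟨σ, ⟨hσ, hcard⟩, _⟩ := ((code.codes_layerBits h0 _).2 j).1 hj
        refine ⟨σ, ?_, by omega⟩
        rcases hσ with rfl | hσ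
        · rw [Finset.card_empty] at hcard
          omega
        · exact hσ
      · rintro i ⟨σ, hσ, hcard⟩
        by_contra hlt
        obtain ⟨τ, hτ, hτc⟩ := Finset.exists_subset_card_eq (s := σ) (n := v.length + 1) (by omega)
        have hempty := code.codes_layerBits h0 (v.length + 1)
        rw [hover] at hempty
        have hmem : τ ∈ {τ ∈ insert ∅ K.faces | τ.card = v.length + 1} :=
          ⟨code.isLowerSet hτ (Or.inr hσ), hτc⟩
        rw [hempty.eq_empty] at hmem
        exact hmem
    rw [complexDim, hgreatest.csSup_eq]
    omega
  obtain ⟨C, f₀, m, hgrad, hC⟩ :=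
    exists_isGradient_of_check code h0 code.codes_all code.isLowerSet hsteps
  obtain ⟨f, hf, hcrit⟩ := hgrad.exists_isDiscreteMorse
  refine isOptimalMorseVector_iff hdim hf (fun i hi => ?_) (fun f' hf' i hi => ?_) u
  · rw [← (hv i hi).1, ← hC]
    by_cases hm : (m ∅).card = 1
    · refine (Set.ncard_le_ncard ?_ (Set.toFinite _)).trans
        ((ncard_setOf_mem_card_le (m ∅ :: C) (i + 1)).trans_eq ?_)
      · rintro σ ⟨h1, h2⟩
        exact ⟨List.mem_cons.2 ((hcrit σ h1).symm.imp And.left id), h2⟩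
      · rw [List.map_cons, hm]
    · refine (Set.ncard_le_ncard ?_ (Set.toFinite _)).trans
        ((ncard_setOf_mem_card_le C (i + 1)).trans List.count_le_count_cons)
      rintro σ ⟨h1, h2⟩
      exact ⟨(hcrit σ h1).resolve_right fun h => hm (h.1 ▸ h.2), h2⟩
  · rcases (hv i hi).2 with hz | ⟨hone, hcyc⟩
    · rw [hz]
      exact Nat.zero_le _
    · obtain ⟨σ, hσ⟩ := exists_isCriticalFace_of_check code hW hcyc hf'
      rw [hone]
      exact (Set.ncard_pos (Set.toFinite _)).2 ⟨σ, hσ⟩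

end Optimal

/-! ### The three triangulations -/

section Triangulations

/-- The words `x aᵏ`, with `k < m`, for the given words `x` in the generators `a` and `b`. They
stand for all elements of the group generated by `a` and `b` if `a` has order `m` and the words `x`
represent the left cosets of the subgroup generated by `a`. -/
def cosetWords (m : ℕ) (xs : List (List Bool)) : List (List Bool) :=
  xs.flatMap fun x => (List.range m).map fun k => x ++ List.replicate k false

/-- Representatives, as words, of the left cosets of the subgroup of the first generator in the group
that defines `SU2_SO3`. -/
def su2so3Cosets : List (List Bool) := [
  [], [true], [true, true]]

/-- A reduction of `SU2_SO3` whose only critical faces, with the vertex of the last collapse, are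
those counted in its discrete Morse vector. -/
def su2so3Steps : List ReductionStep := [
  .critical [2, 3, 8, 9, 11, 12], .collapse 0, .collapse 1, .collapse 10, .collapse 7,
  .collapse 0, .collapse 5, .collapse 7, .collapse 10, .collapse 0, .collapse 4, .collapse 12,
  .collapse 7, .collapse 12, .collapse 6, .critical [5, 6, 7, 12], .collapse 0, .collapse 10,
  .collapse 5, .collapse 4, .critical [4, 6, 10], .collapse 5]

/-- Cycles modulo 2 of `SU2_SO3`, one for each dimension in which a critical face is needed. The
entry of the top dimension is empty, as the sum of all facets is a cycle. -/
def su2so3Cycles : List (List (List ℕ)) := [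
  [[0]],
  [],
  [[0, 1, 2], [0, 1, 3], [0, 2, 3], [1, 2, 3]],
  [[0, 1, 2, 5], [0, 1, 3, 5], [0, 1, 3, 6], [0, 2, 3, 6], [1, 2, 3, 6], [0, 2, 5, 6],
   [1, 2, 5, 6], [0, 1, 2, 9], [0, 2, 3, 9], [1, 2, 3, 9], [0, 3, 5, 9], [1, 3, 5, 9],
   [0, 1, 6, 9], [0, 5, 6, 9], [1, 5, 6, 9]],
  [],
  []]

/-- Cocycles modulo 2 of `SU2_SO3`, each of which has one face in common with the cycle of its
dimension. The entry of dimension zero is empty, as the sum of all vertices is a cocycle. -/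
def su2so3Cocycles : List (List (List ℕ)) := [
  [],
  [],
  [[0, 1, 2], [1, 2, 4], [0, 1, 5], [0, 3, 5], [0, 4, 5], [2, 4, 5], [0, 4, 6], [2, 4, 6],
   [3, 4, 6], [1, 2, 7], [4, 6, 7], [0, 2, 8], [0, 4, 8], [1, 4, 8], [3, 4, 8], [1, 5, 8],
   [2, 5, 8], [3, 5, 8], [2, 6, 8], [0, 7, 8], [1, 7, 8], [3, 7, 8], [6, 7, 8], [1, 2, 9],
   [1, 3, 9], [2, 5, 9], [3, 5, 9], [2, 6, 9], [3, 6, 9], [3, 7, 9], [1, 8, 9], [0, 2, 10],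
   [0, 5, 10], [2, 6, 10], [3, 6, 10], [5, 6, 10], [0, 7, 10], [1, 7, 10], [6, 7, 10], [5, 8, 10],
   [5, 9, 10], [7, 9, 10], [0, 1, 11], [0, 4, 11], [2, 4, 11], [3, 4, 11], [3, 5, 11], [1, 7, 11],
   [3, 7, 11], [6, 7, 11], [1, 9, 11], [4, 9, 11], [6, 9, 11], [0, 10, 11], [3, 10, 11],
   [9, 10, 11]],
  [[1, 2, 5, 6], [2, 3, 5, 6], [1, 4, 5, 6], [2, 3, 5, 7], [2, 5, 6, 9], [4, 5, 6, 9],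
   [2, 6, 8, 9], [4, 6, 8, 9], [2, 3, 4, 10], [2, 3, 6, 10], [2, 3, 7, 10], [2, 4, 9, 10],
   [2, 6, 9, 10], [4, 8, 9, 10], [1, 5, 6, 11], [1, 2, 5, 12], [2, 3, 5, 12], [1, 4, 6, 12],
   [4, 6, 9, 12], [0, 4, 10, 12], [1, 4, 10, 12], [3, 4, 10, 12], [1, 5, 10, 12], [3, 5, 10, 12],
   [3, 7, 10, 12], [4, 9, 10, 12], [1, 4, 11, 12], [1, 5, 11, 12]],
  [],
  [[0, 2, 3, 4, 6, 7]]]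

/-- Representatives, as words, of the left cosets of the subgroup of the first generator in the group
that defines `RP5_24`. -/
def rp5Cosets : List (List Bool) := [
  [], [true], [false, true], [false, false, true]]

/-- Weights of the vertices of `RP5_24` for which distinct faces have distinct indices, found by a
random search. With powers of two the bit sets would have `2 ^ 24` bits; these weights keep them
below `10 ^ 5` bits. -/
def rp5Weights : List ℕ := [
  19816, 25780, 1611, 296, 35762, 7, 2, 845, 629, 2230, 42041, 9725, 1, 4988, 3004, 12940, 4, 13,
  23, 1185, 311, 46, 171, 92]

/-- A reduction of `RP5_24` whose only critical faces, with the vertex of the last collapse, are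
those counted in its discrete Morse vector. -/
def rp5Steps : List ReductionStep := [
  .critical [6, 8, 10, 18, 20, 22], .collapse 0, .collapse 1, .collapse 13, .collapse 4,
  .collapse 23, .collapse 12, .collapse 16, .collapse 19, .collapse 3, .collapse 7, .collapse 19,
  .collapse 17, .collapse 1, .collapse 11, .collapse 9, .collapse 0, .collapse 15, .collapse 20,
  .collapse 4, .collapse 5, .collapse 14, .collapse 9, .collapse 7, .collapse 15, .collapse 12,
  .collapse 19, .collapse 0, .collapse 18, .collapse 14, .collapse 5, .collapse 16, .collapse 0,
  .collapse 7, .collapse 2, .collapse 14, .collapse 22, .collapse 0, .collapse 21,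
  .critical [0, 7, 11, 17, 20], .collapse 5, .collapse 12, .collapse 19, .collapse 2,
  .collapse 16, .collapse 18, .collapse 1, .collapse 23, .collapse 15, .collapse 1, .collapse 9,
  .collapse 21, .collapse 2, .collapse 19, .collapse 5, .collapse 22, .collapse 0, .collapse 4,
  .collapse 15, .collapse 22, .collapse 14, .critical [5, 9, 14, 15], .collapse 23, .collapse 4,
  .collapse 0, .collapse 21, .collapse 5, .collapse 14, .collapse 19, .collapse 2, .collapse 1,
  .collapse 22, .critical [1, 21, 22], .collapse 2, .collapse 14, .collapse 1, .collapse 5,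
  .critical [1, 5], .collapse 14]

/-- Cycles modulo 2 of `RP5_24`, one for each dimension in which a critical face is needed. The
entry of the top dimension is empty, as the sum of all facets is a cycle. -/
def rp5Cycles : List (List (List ℕ)) := [
  [[0]],
  [[0, 3], [0, 4], [3, 4]],
  [[2, 7, 9], [2, 9, 11], [2, 7, 15], [7, 11, 15], [9, 11, 15], [7, 9, 20], [2, 11, 20],
   [7, 11, 20], [2, 15, 20], [9, 15, 20]],
  [[1, 4, 7, 8], [1, 7, 8, 9], [0, 4, 9, 12], [0, 8, 9, 12], [7, 8, 9, 12], [1, 4, 8, 14],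
   [1, 4, 12, 14], [4, 9, 12, 14], [7, 9, 12, 14], [4, 7, 8, 16], [7, 8, 12, 16], [4, 8, 14, 16],
   [4, 9, 14, 16], [0, 4, 9, 18], [0, 8, 9, 18], [1, 8, 9, 18], [1, 8, 14, 18], [1, 12, 14, 18],
   [7, 12, 14, 18], [4, 7, 16, 18], [1, 9, 16, 18], [4, 9, 16, 18], [1, 12, 16, 18],
   [7, 12, 16, 18], [1, 4, 7, 22], [1, 7, 9, 22], [0, 4, 12, 22], [1, 4, 12, 22], [0, 8, 12, 22],
   [7, 9, 14, 22], [1, 9, 16, 22], [1, 12, 16, 22], [8, 12, 16, 22], [8, 14, 16, 22],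
   [9, 14, 16, 22], [0, 4, 18, 22], [4, 7, 18, 22], [0, 8, 18, 22], [7, 14, 18, 22],
   [8, 14, 18, 22]],
  [[2, 7, 9, 10, 14], [0, 2, 8, 11, 14], [2, 8, 10, 11, 14], [2, 9, 10, 11, 14],
   [2, 7, 9, 13, 14], [0, 2, 11, 13, 14], [2, 9, 11, 13, 14], [0, 3, 9, 10, 15],
   [3, 7, 8, 11, 15], [3, 8, 10, 11, 15], [3, 9, 10, 11, 15], [3, 7, 8, 13, 15],
   [0, 3, 10, 13, 15], [3, 8, 10, 13, 15], [8, 10, 11, 14, 15], [9, 10, 11, 14, 15],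
   [0, 7, 8, 11, 16], [0, 3, 10, 13, 16], [6, 9, 11, 13, 16], [0, 8, 11, 14, 16],
   [0, 3, 13, 14, 16], [0, 11, 13, 14, 16], [9, 11, 13, 14, 16], [7, 8, 11, 15, 16],
   [8, 11, 14, 15, 16], [9, 11, 14, 15, 16], [0, 7, 9, 10, 17], [6, 8, 10, 13, 17],
   [0, 2, 11, 13, 17], [7, 9, 10, 14, 17], [0, 9, 10, 15, 17], [0, 2, 13, 15, 17],
   [0, 10, 13, 15, 17], [8, 10, 13, 15, 17], [8, 10, 14, 15, 17], [9, 10, 14, 15, 17],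
   [0, 7, 10, 16, 17], [0, 7, 11, 16, 17], [0, 10, 13, 16, 17], [6, 10, 13, 16, 17],
   [0, 11, 13, 16, 17], [6, 11, 13, 16, 17], [0, 2, 8, 14, 18], [2, 7, 10, 14, 18],
   [2, 8, 10, 14, 18], [0, 2, 13, 14, 18], [0, 3, 13, 14, 18], [2, 7, 13, 14, 18],
   [3, 7, 13, 14, 18], [0, 3, 9, 15, 18], [3, 7, 11, 15, 18], [3, 9, 11, 15, 18],
   [0, 2, 13, 15, 18], [0, 3, 13, 15, 18], [2, 7, 13, 15, 18], [3, 7, 13, 15, 18],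
   [2, 7, 10, 16, 18], [6, 9, 11, 16, 18], [2, 7, 15, 16, 18], [7, 11, 15, 16, 18],
   [9, 11, 15, 16, 18], [6, 8, 10, 17, 18], [3, 7, 11, 17, 18], [3, 7, 14, 17, 18],
   [7, 10, 14, 17, 18], [8, 10, 14, 17, 18], [6, 10, 16, 17, 18], [7, 10, 16, 17, 18],
   [6, 11, 16, 17, 18], [7, 11, 16, 17, 18], [0, 7, 8, 9, 20], [0, 2, 8, 11, 20],
   [0, 7, 8, 11, 20], [3, 7, 8, 11, 20], [2, 8, 10, 11, 20], [3, 8, 10, 11, 20],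
   [3, 7, 8, 13, 20], [6, 8, 9, 13, 20], [7, 8, 9, 13, 20], [3, 8, 10, 13, 20],
   [6, 8, 10, 13, 20], [3, 7, 13, 14, 20], [7, 9, 13, 14, 20], [6, 9, 13, 16, 20],
   [3, 10, 13, 16, 20], [6, 10, 13, 16, 20], [3, 13, 14, 16, 20], [9, 13, 14, 16, 20],
   [9, 14, 15, 16, 20], [0, 7, 9, 17, 20], [0, 2, 11, 17, 20], [0, 7, 11, 17, 20],
   [3, 7, 11, 17, 20], [3, 7, 14, 17, 20], [7, 9, 14, 17, 20], [0, 2, 15, 17, 20],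
   [0, 9, 15, 17, 20], [9, 14, 15, 17, 20], [0, 2, 8, 18, 20], [0, 8, 9, 18, 20],
   [6, 8, 9, 18, 20], [2, 8, 10, 18, 20], [6, 8, 10, 18, 20], [0, 2, 15, 18, 20],
   [0, 9, 15, 18, 20], [6, 9, 16, 18, 20], [2, 10, 16, 18, 20], [6, 10, 16, 18, 20],
   [2, 15, 16, 18, 20], [9, 15, 16, 18, 20], [0, 7, 8, 9, 21], [0, 3, 9, 10, 21],
   [0, 7, 9, 10, 21], [2, 7, 9, 10, 21], [2, 9, 10, 11, 21], [3, 9, 10, 11, 21],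
   [2, 7, 9, 13, 21], [6, 8, 9, 13, 21], [7, 8, 9, 13, 21], [2, 9, 11, 13, 21],
   [6, 9, 11, 13, 21], [2, 7, 13, 15, 21], [7, 8, 13, 15, 21], [0, 7, 8, 16, 21],
   [0, 3, 10, 16, 21], [0, 7, 10, 16, 21], [2, 7, 10, 16, 21], [0, 3, 14, 16, 21],
   [0, 8, 14, 16, 21], [2, 7, 15, 16, 21], [7, 8, 15, 16, 21], [8, 14, 15, 16, 21],
   [6, 8, 13, 17, 21], [2, 11, 13, 17, 21], [6, 11, 13, 17, 21], [2, 13, 15, 17, 21],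
   [8, 13, 15, 17, 21], [8, 14, 15, 17, 21], [0, 3, 9, 18, 21], [0, 8, 9, 18, 21],
   [6, 8, 9, 18, 21], [3, 9, 11, 18, 21], [6, 9, 11, 18, 21], [0, 3, 14, 18, 21],
   [0, 8, 14, 18, 21], [6, 8, 17, 18, 21], [3, 11, 17, 18, 21], [6, 11, 17, 18, 21],
   [3, 14, 17, 18, 21], [8, 14, 17, 18, 21], [2, 10, 11, 20, 21], [3, 10, 11, 20, 21],
   [2, 10, 16, 20, 21], [3, 10, 16, 20, 21], [3, 14, 16, 20, 21], [2, 15, 16, 20, 21],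
   [14, 15, 16, 20, 21], [2, 11, 17, 20, 21], [3, 11, 17, 20, 21], [3, 14, 17, 20, 21],
   [2, 15, 17, 20, 21], [14, 15, 17, 20, 21]],
  []]

/-- Cocycles modulo 2 of `RP5_24`, each of which has one face in common with the cycle of its
dimension. The entry of dimension zero is empty, as the sum of all vertices is a cocycle. -/
def rp5Cocycles : List (List (List ℕ)) := [
  [],
  [[0, 2], [1, 3], [2, 4], [3, 4], [1, 6], [3, 6], [0, 7], [2, 7], [0, 8], [5, 8], [6, 8], [1, 9],
   [5, 9], [7, 9], [8, 9], [4, 10], [5, 10], [6, 10], [7, 10], [0, 11], [1, 11], [3, 12], [7, 12],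
   [8, 12], [11, 12], [2, 13], [6, 13], [9, 13], [11, 13], [12, 13], [0, 14], [3, 14], [5, 14],
   [7, 14], [13, 14], [1, 15], [2, 15], [5, 15], [6, 15], [12, 15], [4, 16], [6, 16], [7, 16],
   [8, 16], [9, 16], [11, 16], [14, 16], [15, 16], [2, 17], [3, 17], [5, 17], [6, 17], [7, 17],
   [11, 17], [1, 18], [2, 18], [8, 18], [10, 18], [12, 18], [14, 18], [16, 18], [17, 18], [0, 19],
   [3, 19], [9, 19], [10, 19], [13, 19], [15, 19], [16, 19], [17, 19], [18, 19], [0, 20], [4, 20],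
   [6, 20], [9, 20], [12, 20], [14, 20], [15, 20], [17, 20], [18, 20], [1, 21], [4, 21], [7, 21],
   [8, 21], [13, 21], [14, 21], [15, 21], [17, 21], [19, 21], [2, 22], [3, 22], [8, 22], [9, 22],
   [10, 22], [11, 22], [14, 22], [15, 22], [20, 22], [21, 22]],
  [[0, 7, 8], [1, 6, 9], [1, 8, 9], [7, 8, 9], [1, 6, 11], [0, 7, 11], [3, 7, 12], [7, 8, 12],
   [7, 11, 12], [2, 6, 13], [6, 9, 13], [8, 9, 13], [6, 11, 13], [2, 12, 13], [7, 12, 13],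
   [9, 12, 13], [1, 3, 14], [3, 4, 14], [3, 6, 14], [3, 12, 14], [6, 13, 14], [12, 13, 14],
   [0, 2, 15], [2, 4, 15], [2, 7, 15], [7, 12, 15], [2, 13, 15], [4, 8, 16], [7, 8, 16],
   [4, 9, 16], [6, 9, 16], [4, 11, 16], [6, 11, 16], [7, 11, 16], [4, 14, 16], [6, 14, 16],
   [4, 15, 16], [7, 15, 16], [0, 2, 17], [1, 3, 17], [2, 4, 17], [3, 4, 17], [0, 11, 17],
   [1, 11, 17], [3, 12, 17], [11, 12, 17], [2, 13, 17], [11, 13, 17], [11, 16, 17], [1, 3, 18],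
   [1, 9, 18], [1, 11, 18], [3, 12, 18], [11, 12, 18], [12, 13, 18], [1, 15, 18], [2, 15, 18],
   [12, 15, 18], [9, 16, 18], [11, 16, 18], [15, 16, 18], [0, 2, 19], [0, 8, 19], [8, 9, 19],
   [0, 11, 19], [2, 13, 19], [11, 13, 19], [0, 14, 19], [3, 14, 19], [13, 14, 19], [8, 16, 19],
   [11, 16, 19], [14, 16, 19], [0, 18, 19], [3, 18, 19], [9, 18, 19], [13, 18, 19], [15, 18, 19],
   [0, 7, 20], [0, 9, 20], [4, 9, 20], [6, 9, 20], [8, 9, 20], [7, 12, 20], [9, 12, 20],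
   [4, 14, 20], [6, 14, 20], [12, 14, 20], [0, 15, 20], [4, 15, 20], [0, 17, 20], [4, 17, 20],
   [12, 17, 20], [9, 18, 20], [15, 18, 20], [0, 19, 20], [1, 6, 21], [1, 8, 21], [4, 8, 21],
   [7, 8, 21], [6, 13, 21], [8, 13, 21], [12, 13, 21], [1, 14, 21], [4, 14, 21], [4, 15, 21],
   [7, 15, 21], [13, 15, 21], [1, 17, 21], [4, 17, 21], [13, 17, 21], [1, 18, 21], [8, 19, 21],
   [14, 19, 21], [18, 19, 21], [2, 17, 22], [3, 17, 22], [11, 17, 22], [17, 20, 22], [17, 21, 22]],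
  [[2, 4, 10, 16], [2, 7, 10, 16], [0, 10, 12, 16], [7, 10, 12, 16], [2, 5, 11, 17],
   [5, 6, 11, 17], [0, 7, 11, 17], [6, 7, 11, 17], [0, 11, 12, 17], [7, 11, 16, 17],
   [0, 12, 16, 17], [7, 12, 16, 17], [4, 6, 7, 18], [4, 6, 10, 18], [5, 6, 11, 18],
   [6, 7, 11, 18], [6, 7, 16, 18], [4, 10, 16, 18], [7, 10, 16, 18], [7, 16, 17, 18],
   [5, 11, 17, 19], [7, 11, 17, 19], [2, 4, 10, 20], [0, 11, 17, 20], [2, 11, 17, 20],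
   [4, 10, 18, 20], [11, 17, 19, 20], [2, 5, 11, 21], [5, 6, 11, 21], [2, 10, 16, 21],
   [10, 12, 16, 21], [2, 10, 20, 21], [2, 11, 20, 21], [0, 4, 6, 22], [0, 4, 12, 22],
   [0, 12, 17, 22], [4, 6, 18, 22], [0, 4, 20, 22], [2, 4, 20, 22], [0, 17, 20, 22],
   [2, 17, 20, 22], [4, 18, 20, 22], [2, 20, 21, 22], [0, 5, 6, 23], [0, 5, 12, 23],
   [0, 12, 16, 23], [5, 6, 18, 23], [6, 7, 18, 23], [2, 5, 21, 23], [5, 6, 21, 23],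
   [5, 12, 21, 23], [2, 16, 21, 23], [12, 16, 21, 23], [2, 20, 21, 23], [0, 6, 22, 23],
   [0, 12, 22, 23], [6, 18, 22, 23]],
  [[2, 7, 12, 15, 16], [7, 11, 12, 16, 18], [7, 12, 15, 16, 18], [5, 6, 11, 17, 18],
   [6, 7, 11, 17, 18], [7, 11, 16, 17, 18], [2, 5, 6, 15, 21], [2, 5, 12, 15, 21],
   [2, 12, 15, 16, 21], [2, 5, 6, 17, 21], [5, 6, 11, 17, 21]],
  [[2, 7, 9, 10, 12, 14]]]

/-- Representatives, as words, of the left cosets of the subgroup of the first generator in the group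
that defines `HP2`. -/
def hp2Cosets : List (List Bool) := [
  [], [true], [false, true], [false, false, true], [false, false, false, true],
  [true, false, false, true], [true, false, false, false, true], [true, true, false, false, true],
  [true, true, false, false, false, true], [false, true, true, false, false, false, true],
  [false, false, true, true, false, false, false, true],
  [true, false, false, true, true, false, false, false, true]]

/-- A reduction of `HP2` whose only critical faces, with the vertex of the last collapse, are those
counted in its discrete Morse vector. -/
def hp2Steps : List ReductionStep := [
  .critical [2, 4, 5, 6, 8, 9, 10, 11, 14], .collapse 7, .collapse 1, .collapse 0, .collapse 4,
  .collapse 14, .collapse 0, .collapse 13, .collapse 9, .collapse 1, .collapse 3, .collapse 5,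
  .collapse 4, .collapse 9, .collapse 13, .collapse 6, .collapse 0, .collapse 13, .collapse 2,
  .collapse 1, .collapse 12, .critical [0, 1, 2, 12, 13], .collapse 3]

/-- Cycles modulo 2 of `HP2`, one for each dimension in which a critical face is needed. The entry
of the top dimension is empty, as the sum of all facets is a cycle. -/
def hp2Cycles : List (List (List ℕ)) := [
  [[0]],
  [],
  [],
  [],
  [[0, 1, 2, 5, 6], [0, 1, 2, 5, 7], [0, 1, 2, 6, 7], [0, 1, 5, 6, 7], [0, 2, 5, 6, 7],
   [1, 2, 5, 6, 7]],
  [],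
  [],
  [],
  []]

/-- Cocycles modulo 2 of `HP2`, each of which has one face in common with the cycle of its
dimension. The entry of dimension zero is empty, as the sum of all vertices is a cocycle. -/
def hp2Cocycles : List (List (List ℕ)) := [
  [],
  [],
  [],
  [],
  [[0, 1, 4, 6, 7], [1, 2, 4, 6, 7], [0, 3, 4, 6, 7], [2, 3, 4, 6, 7], [1, 2, 5, 6, 7],
   [1, 2, 6, 7, 8], [0, 2, 3, 5, 9], [1, 2, 3, 5, 9], [2, 3, 4, 5, 9], [0, 1, 5, 6, 9],
   [0, 3, 5, 6, 9], [2, 3, 5, 7, 9], [0, 1, 6, 7, 9], [1, 2, 6, 7, 9], [0, 3, 6, 7, 9],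
   [2, 3, 6, 7, 9], [0, 1, 2, 8, 9], [0, 1, 3, 8, 9], [0, 1, 4, 8, 9], [0, 3, 5, 8, 9],
   [0, 1, 6, 8, 9], [0, 3, 7, 8, 9], [2, 3, 7, 8, 9], [0, 1, 2, 4, 10], [0, 2, 3, 4, 10],
   [1, 2, 4, 5, 10], [2, 3, 4, 5, 10], [0, 1, 4, 6, 10], [0, 3, 4, 6, 10], [1, 4, 5, 6, 10],
   [0, 2, 4, 7, 10], [2, 4, 5, 7, 10], [2, 4, 6, 7, 10], [0, 1, 4, 8, 10], [0, 3, 4, 8, 10],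
   [1, 4, 5, 8, 10], [3, 4, 5, 8, 10], [0, 2, 7, 8, 10], [2, 5, 7, 8, 10], [2, 6, 7, 8, 10],
   [0, 1, 2, 9, 10], [0, 2, 3, 9, 10], [0, 1, 6, 9, 10], [0, 3, 6, 9, 10], [0, 2, 7, 9, 10],
   [2, 5, 7, 9, 10], [2, 6, 7, 9, 10], [0, 3, 8, 9, 10], [0, 2, 3, 5, 11], [1, 2, 3, 5, 11],
   [2, 3, 4, 5, 11], [2, 3, 5, 7, 11], [2, 4, 6, 7, 11], [2, 5, 6, 7, 11], [2, 3, 5, 8, 11],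
   [2, 6, 7, 8, 11], [0, 5, 6, 9, 11], [0, 6, 7, 9, 11], [2, 6, 7, 9, 11], [1, 3, 8, 9, 11],
   [3, 5, 8, 9, 11], [0, 6, 8, 9, 11], [3, 6, 8, 9, 11], [3, 7, 8, 9, 11], [0, 2, 3, 10, 11],
   [0, 1, 4, 10, 11], [1, 4, 5, 10, 11], [0, 2, 7, 10, 11], [2, 5, 7, 10, 11], [0, 3, 8, 10, 11],
   [3, 5, 8, 10, 11], [0, 6, 9, 10, 11], [1, 4, 6, 7, 12], [1, 5, 6, 7, 12], [0, 1, 2, 8, 12],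
   [0, 1, 3, 8, 12], [0, 1, 4, 8, 12], [0, 1, 5, 8, 12], [0, 1, 6, 8, 12], [1, 6, 7, 8, 12],
   [0, 2, 5, 9, 12], [0, 5, 6, 9, 12], [0, 5, 7, 9, 12], [3, 5, 7, 9, 12], [1, 6, 7, 9, 12],
   [3, 6, 7, 9, 12], [0, 5, 8, 9, 12], [3, 7, 8, 9, 12], [0, 2, 4, 10, 12], [2, 4, 5, 10, 12],
   [1, 4, 6, 10, 12], [2, 4, 6, 10, 12], [0, 2, 8, 10, 12], [0, 3, 8, 10, 12], [0, 5, 8, 10, 12],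
   [4, 5, 8, 10, 12], [0, 6, 8, 10, 12], [4, 6, 8, 10, 12], [5, 7, 8, 10, 12], [6, 7, 8, 10, 12],
   [0, 2, 9, 10, 12], [0, 6, 9, 10, 12], [4, 6, 9, 10, 12], [5, 7, 9, 10, 12], [6, 7, 9, 10, 12],
   [1, 2, 4, 11, 12], [0, 2, 5, 11, 12], [2, 4, 5, 11, 12], [2, 4, 6, 11, 12], [1, 4, 7, 11, 12],
   [1, 5, 7, 11, 12], [2, 5, 7, 11, 12], [1, 3, 8, 11, 12], [1, 4, 8, 11, 12], [1, 5, 8, 11, 12],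
   [2, 5, 8, 11, 12], [1, 6, 8, 11, 12], [2, 6, 8, 11, 12], [5, 7, 9, 11, 12], [6, 7, 9, 11, 12],
   [5, 8, 9, 11, 12], [6, 8, 9, 11, 12], [0, 2, 10, 11, 12], [1, 4, 10, 11, 12],
   [5, 8, 10, 11, 12], [6, 8, 10, 11, 12], [0, 1, 3, 4, 13], [1, 2, 3, 4, 13], [0, 3, 4, 5, 13],
   [2, 3, 4, 5, 13], [1, 3, 4, 6, 13], [1, 3, 5, 6, 13], [0, 3, 4, 7, 13], [2, 3, 4, 7, 13],
   [1, 4, 6, 7, 13], [1, 5, 6, 7, 13], [0, 1, 4, 8, 13], [1, 2, 4, 8, 13], [0, 4, 5, 8, 13],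
   [2, 4, 5, 8, 13], [1, 4, 6, 8, 13], [1, 5, 6, 8, 13], [2, 4, 7, 8, 13], [0, 1, 3, 9, 13],
   [1, 2, 3, 9, 13], [0, 3, 5, 9, 13], [1, 3, 6, 9, 13], [0, 3, 7, 9, 13], [2, 3, 7, 9, 13],
   [1, 6, 7, 9, 13], [1, 6, 8, 9, 13], [1, 2, 4, 10, 13], [0, 3, 4, 10, 13], [1, 4, 6, 10, 13],
   [2, 4, 7, 10, 13], [4, 5, 8, 10, 13], [0, 3, 9, 10, 13], [1, 6, 9, 10, 13], [2, 7, 9, 10, 13],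
   [1, 3, 4, 11, 13], [0, 3, 5, 11, 13], [1, 3, 5, 11, 13], [1, 4, 7, 11, 13], [2, 4, 7, 11, 13],
   [3, 5, 7, 11, 13], [4, 5, 7, 11, 13], [5, 6, 7, 11, 13], [1, 4, 8, 11, 13], [3, 5, 8, 11, 13],
   [4, 5, 8, 11, 13], [5, 6, 8, 11, 13], [1, 3, 9, 11, 13], [3, 7, 9, 11, 13], [4, 7, 9, 11, 13],
   [6, 7, 9, 11, 13], [6, 8, 9, 11, 13], [0, 3, 10, 11, 13], [1, 4, 10, 11, 13],
   [5, 7, 10, 11, 13], [7, 9, 10, 11, 13], [0, 1, 3, 12, 13], [2, 3, 4, 12, 13],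
   [0, 3, 5, 12, 13], [1, 3, 6, 12, 13], [2, 4, 8, 12, 13], [0, 5, 8, 12, 13], [1, 6, 8, 12, 13],
   [3, 7, 9, 12, 13], [0, 3, 10, 12, 13], [2, 4, 10, 12, 13], [6, 8, 10, 12, 13],
   [6, 9, 10, 12, 13], [1, 3, 11, 12, 13], [2, 4, 11, 12, 13], [5, 7, 11, 12, 13],
   [5, 8, 11, 12, 13]],
  [],
  [],
  [],
  [[0, 1, 2, 3, 4, 6, 7, 9, 10]]]

end Triangulations

theorem isOptimalMorseVector_SU2_SO3 (v : List ℕ) :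
    IsOptimalMorseVector SU2_SO3 v ↔ v = [1, 0, 1, 1, 0, 1] :=
  isOptimalMorseVector_orbitComplex (cosetWords 13 su2so3Cosets) (by decide +kernel)
    ((List.range 13).map (2 ^ ·)) su2so3Steps _ su2so3Cycles su2so3Cocycles (by decide +kernel) v

theorem isOptimalMorseVector_RP5_24 (v : List ℕ) :
    IsOptimalMorseVector RP5_24 v ↔ v = [1, 1, 1, 1, 1, 1] :=
  isOptimalMorseVector_orbitComplex (cosetWords 3 rp5Cosets) (by decide +kernel)
    rp5Weights rp5Steps _ rp5Cycles rp5Cocycles (by decide +kernel) v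

theorem isOptimalMorseVector_HP2 (v : List ℕ) :
    IsOptimalMorseVector HP2 v ↔ v = [1, 0, 0, 0, 1, 0, 0, 0, 1] :=
  isOptimalMorseVector_orbitComplex (cosetWords 5 hp2Cosets) (by decide +kernel)
    ((List.range 15).map (2 ^ ·)) hp2Steps _ hp2Cycles hp2Cocycles (by decide +kernel) v

theorem mainTheorem4 :
    (∀ v : List ℕ, IsOptimalMorseVector SU2_SO3 v ↔ v = [1, 0, 1, 1, 0, 1]) ∧
    (∀ v : List ℕ, IsOptimalMorseVector RP5_24 v ↔ v = [1, 1, 1, 1, 1, 1]) ∧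
    (∀ v : List ℕ, IsOptimalMorseVector HP2 v ↔ v = [1, 0, 0, 0, 1, 0, 0, 0, 1]) :=
  ⟨isOptimalMorseVector_SU2_SO3, isOptimalMorseVector_RP5_24, isOptimalMorseVector_HP2⟩
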